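/- Let $\mathcal M=(E,\mathcal I)$ be a matroid on a finite ground set $E$, and let $\succ$ be a total order on $E$ (the value order; $e\succ f$ means that $e$ is more valuable). For $S\subseteq E$ let $\mathrm{OPT}(S)$ be the lexicographically maximal independent subset of $S$ with respect to $\succ$. The elements have independent arrival times $t_e$, uniform on $[0,1]$, and an element $e$ is improving if $e\in\mathrm{OPT}(\{f\in E: t_f\le t_e\})$. The greedy-improving algorithm with sample fraction $p$ skips all elements that arrive before time $p$, and then goes through the elements with $t_e\in[p,1]$ in order of arrival, selecting $e$ whenever $e$ is improving and can be added to the set of already selected elements without losing independence. The algorithm is $\alpha$-probability-competitive on $(\mathcal M,\succ)$ if every element of $\mathrm{OPT}(E)$ is selected with probability at least $\alpha$; its probability-competitive ratio on $(\mathcal M,\succ)$ is the largest such $\alpha\in[0,1]$. A matroid is laminar if, for some family $C_1,\dots,C_m$ of subsets of $E$, any two of which are nested or disjoint, and some $g_1,\dots,g_m\in\mathbb N$, its independent sets are exactly the sets $I\subseteq E$ with $|I\cap C_i|\le g_i$ for all $i$. **Theorem.** The greedy-improving algorithm with sample fraction $p=1/2$ is $(1-\ln 2)$-probability-competitive ($1-\ln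 2\approx 0.3068$) on every finite laminar matroid with every value order. The bound is tight: for every $\varepsilon>0$ there are integers $r$ and $q$ such that the following holds. Let $E=F_1\sqcup\dots\sqcup F_r$ with $|F_i|=q$ for all $i$, and let $E_i=F_1\cup\dots\cup F_i$. The sets $I\subseteq E$ with $|I\cap E_i|\le i$ for all $i$ are the independent sets of a loopless laminar matroid $\mathcal M$, and for every value order $\succ$ with $e\succ f$ whenever $e\in F_i$, $f\in F_j$ and $i<j$, the probability-competitive ratio of the greedy-improving algorithm with $p=1/2$ on $(\mathcal M,\succ)$ is at most $1-\ln 2+\varepsilon$. -/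

import Mathlib

namespace MatroidSecretary

/-- `M` is a laminar matroid: for some laminar family `C 0, …, C (q-1)` of subsets of the ground
set (any two members are nested or disjoint) and upper bounds `g 0, …, g (q-1)`, the independent
sets are exactly the subsets of the ground set that contain at most `g i` elements of each `C i`. -/
def IsLaminar {E : Type*} (M : Matroid E) : Prop :=
  ∃ (q : ℕ) (C : Fin q → Set E) (g : Fin q → ℕ),
    (∀ i, C i ⊆ M.E) ∧
    (∀ i j, C i ⊆ C j ∨ C j ⊆ C i ∨ Disjoint (C i) (C j)) ∧
    ∀ I : Set E, M.Indep I ↔ I ⊆ M.E ∧ ∀ i, (I ∩ C i).encard ≤ (g i : ℕ∞)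

/-- `B` is the lexicographically maximal independent subset of `S` for the value order `succ`
(`succ e f` means that `e` is more valuable than `f`): whenever `J` is another independent subset
of `S`, the most valuable element on which `B` and `J` differ belongs to `B`. -/
def IsLexMax {E : Type*} (M : Matroid E) (succ : E → E → Prop) (S B : Set E) : Prop :=
  (B ⊆ S ∧ M.Indep B) ∧
    ∀ J : Set E, J ⊆ S → M.Indep J → J ≠ B →
      ∃ e, e ∈ B ∧ e ∉ J ∧ ∀ f, succ f e → (f ∈ B ↔ f ∈ J)

/-- `OPT(S)`, the (unique) lexicographically maximal independent subset of `S`, given as the set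
of its elements. -/
def opt {E : Type*} (M : Matroid E) (succ : E → E → Prop) (S : Set E) : Set E :=
  {e | ∃ B, IsLexMax M succ S B ∧ e ∈ B}

/-- `e` is improving for the arrival times `t`: it belongs to the optimum of the set of elements
that have arrived up to (and including) its own arrival. -/
def IsImproving {E : Type*} (M : Matroid E) (succ : E → E → Prop) (t : E → unitInterval)
    (e : E) : Prop :=
  e ∈ opt M succ {f | t f ≤ t e}

open Classical in
/-- The loop of the greedy-improving algorithm: process the elements of a list one by one, starting
with the set `A` of already selected elements; the current element is selected if it is improving
and can be added to the selected elements without losing independence. -/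
noncomputable def greedyLoop {E : Type*} (M : Matroid E) (succ : E → E → Prop)
    (t : E → unitInterval) : List E → Set E → Set E
  | [], A => A
  | e :: l, A =>
    greedyLoop M succ t l
      (if IsImproving M succ t e ∧ M.Indep (insert e A) then insert e A else A)

open Classical in
/-- The elements that arrive in `[p, 1]`, in the order of their arrival times (the times are almost
surely distinct; ties are broken in a fixed way). -/
noncomputable def arrivalList {E : Type*} [Fintype E] (p : ℝ) (t : E → unitInterval) : List E :=
  ((Finset.univ : Finset E).toList.filter (fun e => decide (p ≤ (t e : ℝ)))).mergeSort
    (fun e f => decide (t e ≤ t f))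

/-- The output of the greedy-improving algorithm with sample fraction `p` for the arrival
times `t`. -/
noncomputable def greedyImproving {E : Type*} [Fintype E] (p : ℝ) (M : Matroid E)
    (succ : E → E → Prop) (t : E → unitInterval) : Set E :=
  greedyLoop M succ t (arrivalList p t) ∅

/-- The law of the arrival times: independent and uniform on `[0, 1]`. -/
noncomputable def arrivalLaw (E : Type*) [Fintype E] : MeasureTheory.Measure (E → unitInterval) :=
  MeasureTheory.Measure.pi fun _ => MeasureTheory.volume

/-- The greedy-improving algorithm with sample fraction `p` is `α`-probability-competitive on the
matroid `M` with value order `succ`: every element of `OPT(E)` is selected with probability at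
least `α`. -/
def IsProbCompetitive {E : Type*} [Fintype E] (p : ℝ) (M : Matroid E) (succ : E → E → Prop)
    (α : ℝ) : Prop :=
  ∀ e ∈ opt M succ M.E, α ≤ (arrivalLaw E).real {t | e ∈ greedyImproving p M succ t}

/-- The probability-competitive ratio of the greedy-improving algorithm on the matroid `M` with
value order `succ`: the largest `α ∈ [0, 1]` for which it is `α`-probability-competitive. -/
noncomputable def probCompetitiveRatio {E : Type*} [Fintype E] (p : ℝ) (M : Matroid E)
    (succ : E → E → Prop) : ℝ :=
  sSup {α : ℝ | α ∈ Set.Icc (0 : ℝ) 1 ∧ IsProbCompetitive p M succ α}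

end MatroidSecretary

namespace MatroidSecretary

open MeasureTheory

/-! Fix `e` in the optimum of `E`. It is improving whenever it arrives, so it is selected exactly
when it arrives after time 1/2 and is not spanned by the improving elements that arrived between 1/2
and `e`. By laminarity the constraint sets through `e` form a chain, and Hall's theorem assigns to
the elements of each optimum distinct letters such that an element of a constraint set of capacity
`n` gets a letter below `n`. If for every `j` at most `j` letters `≤ j` occur before `e`, then no
constraint through `e` is full and `e` is selected.

The arrivals before `e` are explored backwards in time. Given that the unexplored set `S` arrives
before `y`, each element of `S` is the last arrival at rate `1/y`, and its letter depends only on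
`S` and on that element. Each letter thus occurs at rate at most `1/y`, and if `e` arrives at `x`,
the letters compare with independent Poisson variables of mean `log (2 * x)`. A parking-function
count (`wordCount_zero`) shows that Poisson letters of mean `m < 1` are admissible with probability
at least `1 - m` (`one_sub_le_poissonAdmissible`), and integrating `1 - log (2 * x)` over `[1/2, 1]`
gives `1 - log 2`. The comparison is a differential inequality along the recursion for the last
arrival (`le_of_last_arrival_recursion`).

For tightness, in the nested matroid the best arrived element of each row is in the current optimum.
With row indices as letters and `e` the best element of the first row, admissibility is necessary
for selection, and each letter occurs at rate at least `1/y` unless some row has no unexplored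
element. Two errors remain: the probability of a missing row, small for large `q`, and the excess of
the Poisson probability over `1 - m`, exponentially small in `r`. -/

/-! ### Counting admissible words -/

/-- A vector of letter multiplicities is admissible for the alphabet `{0, …, r-1}` if, for every
letter `j`, at most `j` letters are less than or equal to `j`. -/
def Admissible (r : ℕ) (c : ℕ → ℕ) : Prop :=
  ∀ j < r, ∑ i ∈ Finset.range (j + 1), c i ≤ j

open Classical in
/-- The number of words of length `n` over the alphabet `{0, …, r-1}` whose letter
multiplicities, added to `c`, are admissible. -/
noncomputable def wordCount (r : ℕ) : ℕ → (ℕ → ℕ) → ℝ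
  | 0, c => if Admissible r c then 1 else 0
  | n + 1, c => ∑ l ∈ Finset.range r, wordCount r n (c + Pi.single l 1)

/-- The probability that independent Poisson letter multiplicities of mean `x`, added to `c`,
are admissible. -/
noncomputable def poissonAdmissible (r : ℕ) (c : ℕ → ℕ) (x : ℝ) : ℝ :=
  Real.exp (-(r * x)) * ∑ n ∈ Finset.range (r + 1), x ^ n / n.factorial * wordCount r n c

lemma Admissible.of_add {r : ℕ} {c d : ℕ → ℕ} (h : Admissible r (c + d)) : Admissible r c :=
  fun j hj => (Finset.sum_le_sum fun _ _ => Nat.le_add_right _ _).trans (h j hj)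

lemma Admissible.congr {r : ℕ} {c d : ℕ → ℕ} (h : Admissible r c) (hcd : ∀ i < r, c i = d i) :
    Admissible r d := by
  intro j hj
  rw [← Finset.sum_congr rfl fun i hi => hcd i (by have := Finset.mem_range.1 hi; omega)]
  exact h j hj

lemma admissible_congr {r : ℕ} {c d : ℕ → ℕ} (hcd : ∀ i < r, c i = d i) :
    Admissible r c ↔ Admissible r d :=
  ⟨fun h => h.congr hcd, fun h => h.congr fun i hi => (hcd i hi).symm⟩

lemma wordCount_nonneg (r n : ℕ) (c : ℕ → ℕ) : 0 ≤ wordCount r n c := by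
  induction n generalizing c with
  | zero => unfold wordCount; split_ifs <;> norm_num
  | succ n ih => unfold wordCount; exact Finset.sum_nonneg fun _ _ => ih _

lemma wordCount_congr {r n : ℕ} {c d : ℕ → ℕ} (hcd : ∀ i < r, c i = d i) :
    wordCount r n c = wordCount r n d := by
  induction n generalizing c d with
  | zero =>
    have h := admissible_congr hcd
    by_cases hd : Admissible r d <;> simp [wordCount, h, hd]
  | succ n ih =>
    unfold wordCount
    refine Finset.sum_congr rfl fun l _ =>
      ih (c := c + Pi.single l 1) (d := d + Pi.single l 1) fun i hi => ?_
    simp [hcd i hi]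

lemma wordCount_add_le (r n : ℕ) (c d : ℕ → ℕ) : wordCount r n (c + d) ≤ wordCount r n c := by
  induction n generalizing c with
  | zero =>
    unfold wordCount
    split_ifs with h1 h2 <;> norm_num
    exact h2 h1.of_add
  | succ n ih =>
    unfold wordCount
    refine Finset.sum_le_sum fun l _ => ?_
    rw [add_right_comm]
    exact ih _

lemma sum_add_single {r l : ℕ} (hl : l < r) (c : ℕ → ℕ) :
    ∑ i ∈ Finset.range r, (c + Pi.single l 1 : ℕ → ℕ) i = ∑ i ∈ Finset.range r, c i + 1 := by
  simp only [Pi.add_apply, Finset.sum_add_distrib]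
  congr 1
  rw [Finset.sum_pi_single']
  simp [hl]

lemma admissible_succ {r : ℕ} {c : ℕ → ℕ} :
    Admissible (r + 1) c ↔ Admissible r c ∧ ∑ i ∈ Finset.range (r + 1), c i ≤ r := by
  constructor
  · exact fun h => ⟨fun j hj => h j (by omega), h r (by omega)⟩
  · rintro ⟨h1, h2⟩ j hj
    rcases Nat.lt_succ_iff_lt_or_eq.1 hj with h | rfl
    · exact h1 j h
    · exact h2

/-- The top letter `r` enters only the constraint on the total. Hence one chooses the `k` positions
of the smaller letters, fills them admissibly, and puts `r` elsewhere. The induction on `n` is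
Pascal's rule. -/
lemma wordCount_succ_alphabet (r n : ℕ) (c : ℕ → ℕ) :
    wordCount (r + 1) n c =
      if ∑ i ∈ Finset.range (r + 1), c i + n ≤ r then
        ∑ k ∈ Finset.range (n + 1), (n.choose k : ℝ) * wordCount r k c else 0 := by
  classical
  induction n generalizing c with
  | zero =>
    simp only [wordCount, admissible_succ, add_zero, zero_add, Finset.sum_range_one,
      Nat.choose_self, Nat.cast_one, one_mul]
    split_ifs <;> tauto
  | succ n ih =>
    have e0 : ∀ l ∈ Finset.range (r + 1), wordCount (r + 1) n (c + Pi.single l 1) =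
        if ∑ i ∈ Finset.range (r + 1), c i + (n + 1) ≤ r then
          ∑ k ∈ Finset.range (n + 1), (n.choose k : ℝ) * wordCount r k (c + Pi.single l 1)
        else 0 := by
      intro l hl
      rw [ih, sum_add_single (Finset.mem_range.1 hl), add_right_comm, add_assoc]
    rw [wordCount, Finset.sum_congr rfl e0]
    split_ifs with h
    · rw [Finset.sum_range_succ, Finset.sum_comm]
      have e2 : ∀ k, wordCount r k (c + Pi.single r 1) = wordCount r k c := fun k =>
        wordCount_congr (c := c + Pi.single r 1) (d := c) fun i hi => by simp [hi.ne]
      simp only [e2, ← Finset.mul_sum]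
      have e3 : ∀ k, ∑ l ∈ Finset.range r, wordCount r k (c + Pi.single l 1)
          = wordCount r (k + 1) c := fun k => rfl
      simp only [e3]
      rw [Finset.sum_range_succ' _ (n + 1)]
      have e4 : ∀ k, (((n + 1).choose (k + 1) : ℕ) : ℝ) * wordCount r (k + 1) c
          = (n.choose k : ℝ) * wordCount r (k + 1) c
            + (n.choose (k + 1) : ℝ) * wordCount r (k + 1) c := by
        intro k
        rw [Nat.choose_succ_succ]; push_cast; ring
      simp only [e4, Finset.sum_add_distrib]
      rw [add_assoc]
      congr 1
      rw [Finset.sum_range_succ' _ n, Finset.sum_range_succ _ n]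
      simp
    · simp

lemma wordCount_eq_zero {r n : ℕ} (c : ℕ → ℕ) (h : r < n) : wordCount r n c = 0 := by
  rcases r with _ | r
  · obtain ⟨n, rfl⟩ : ∃ m, n = m + 1 := ⟨n - 1, by omega⟩
    simp [wordCount]
  · rw [wordCount_succ_alphabet, if_neg (by omega)]

lemma sum_choose_mul_deriv (r : ℝ) (n : ℕ) :
    ∑ k ∈ Finset.range (n + 1), (n.choose k : ℝ) * (k * r ^ (k - 1)) = n * (r + 1) ^ (n - 1) := by
  rcases n with _ | n
  · simp
  · rw [Finset.sum_range_succ']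
    simp only [Nat.add_sub_cancel, add_pow, one_pow, mul_one, Finset.mul_sum]
    simp only [Nat.cast_zero, zero_mul, mul_zero, add_zero]
    refine Finset.sum_congr rfl fun k _ => ?_
    have := Nat.add_one_mul_choose_eq n k
    have h2 : ((n + 1 : ℕ) : ℝ) * (n.choose k : ℝ) = ((n + 1).choose (k + 1) : ℝ) * ((k + 1 : ℕ) : ℝ) := by
      exact_mod_cast this
    linear_combination -(r ^ k) * h2

/-- A count of parking-function type, `(r - n) * r ^ (n - 1)`. The binomial sum over the smaller
letters replaces `r` by `r + 1`, both in the power and in its derivative. -/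
lemma wordCount_zero (r n : ℕ) (h : n ≤ r) :
    wordCount r n 0 = (r : ℝ) ^ n - n * (r : ℝ) ^ (n - 1) := by
  induction r generalizing n with
  | zero =>
    obtain rfl : n = 0 := by omega
    simp [wordCount, Admissible]
  | succ r ih =>
    rw [wordCount_succ_alphabet]
    simp only [Pi.zero_apply, Finset.sum_const_zero, zero_add]
    split_ifs with hn
    · rw [Finset.sum_congr rfl fun k hk => by rw [ih k (by simp at hk; omega)]]
      simp only [mul_sub, Finset.sum_sub_distrib]
      rw [sum_choose_mul_deriv]
      push_cast
      congr 1
      rw [add_pow]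
      exact Finset.sum_congr rfl fun k _ => by simp; ring
    · obtain rfl : n = r + 1 := by omega
      simp [pow_succ]; ring

/-! ### Poisson letter multiplicities -/

lemma poissonAdmissible_zero_right (r : ℕ) (c : ℕ → ℕ) :
    poissonAdmissible r c 0 = wordCount r 0 c := by
  unfold poissonAdmissible
  rw [Finset.sum_range_succ']
  simp

lemma poissonAdmissible_nonneg (r : ℕ) (c : ℕ → ℕ) {x : ℝ} (hx : 0 ≤ x) :
    0 ≤ poissonAdmissible r c x :=
  mul_nonneg (Real.exp_pos _).le (Finset.sum_nonneg fun n _ =>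
    mul_nonneg (by positivity) (wordCount_nonneg _ _ _))

lemma poissonAdmissible_add_le (r : ℕ) (c d : ℕ → ℕ) {x : ℝ} (hx : 0 ≤ x) :
    poissonAdmissible r (c + d) x ≤ poissonAdmissible r c x := by
  unfold poissonAdmissible
  gcongr
  exact wordCount_add_le _ _ _ _

lemma poissonAdmissible_congr {r : ℕ} {c d : ℕ → ℕ} (hcd : ∀ i < r, c i = d i) (x : ℝ) :
    poissonAdmissible r c x = poissonAdmissible r d x := by
  unfold poissonAdmissible
  simp only [wordCount_congr hcd]

/-- The forward equation of `r` independent Poisson processes: at unit rate, each letter is added to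
`c`. -/
lemma hasDerivAt_poissonAdmissible (r : ℕ) (c : ℕ → ℕ) (x : ℝ) :
    HasDerivAt (poissonAdmissible r c)
      (∑ l ∈ Finset.range r,
        (poissonAdmissible r (c + Pi.single l 1) x - poissonAdmissible r c x)) x := by
  have h1 : HasDerivAt (fun x : ℝ => Real.exp (-(r * x))) (Real.exp (-(r * x)) * (-(r * 1))) x :=
    (((hasDerivAt_id x).const_mul (r : ℝ)).neg).exp
  have h2 : HasDerivAt (fun x : ℝ => ∑ n ∈ Finset.range (r + 1),
      x ^ n / n.factorial * wordCount r n c)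
      (∑ n ∈ Finset.range (r + 1), (n * x ^ (n - 1)) / n.factorial * wordCount r n c) x :=
    HasDerivAt.fun_sum fun n _ => ((hasDerivAt_pow n x).div_const _).mul_const _
  refine (h1.mul h2).congr_deriv ?_
  -- After the index shift the top term vanishes, since no admissible word has more than `r`
  -- letters.
  have h3 : ∑ n ∈ Finset.range (r + 1), (n * x ^ (n - 1)) / n.factorial * wordCount r n c
      = ∑ n ∈ Finset.range (r + 1), x ^ n / n.factorial * wordCount r (n + 1) c := by
    rw [Finset.sum_range_succ', Finset.sum_range_succ, wordCount_eq_zero c (Nat.lt_succ_self r)]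
    simp only [Nat.cast_zero, zero_mul, zero_div, mul_zero, add_zero]
    refine Finset.sum_congr rfl fun n _ => ?_
    rw [Nat.factorial_succ, Nat.add_sub_cancel]
    push_cast
    have : (n : ℝ) + 1 ≠ 0 := by positivity
    field_simp
  rw [h3]
  simp only [poissonAdmissible, Finset.sum_sub_distrib, Finset.sum_const, Finset.card_range,
    nsmul_eq_mul, ← Finset.mul_sum]
  rw [Finset.sum_comm]
  simp only [← Finset.mul_sum, wordCount]
  ring

lemma poissonAdmissible_zero_left (r : ℕ) (x : ℝ) :
    poissonAdmissible r 0 x = Real.exp (-(r * x)) *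
      ((1 - x) * ∑ n ∈ Finset.range r, (r * x) ^ n / n.factorial + (r * x) ^ r / r.factorial) := by
  unfold poissonAdmissible
  congr 1
  rw [Finset.sum_congr rfl fun n hn => by rw [wordCount_zero r n (by simp at hn; omega)]]
  have : ∀ n : ℕ, x ^ n / n.factorial * ((r : ℝ) ^ n - n * (r : ℝ) ^ (n - 1))
      = (r * x) ^ n / n.factorial - n * (r : ℝ) ^ (n - 1) * x ^ n / n.factorial := by
    intro n; rw [mul_pow]; ring
  simp only [this, Finset.sum_sub_distrib]
  rw [Finset.sum_range_succ, Finset.sum_range_succ' (fun n : ℕ => n * (r : ℝ) ^ (n - 1) * x ^ n / n.factorial)]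
  have h2 : ∑ n ∈ Finset.range r, ((n + 1 : ℕ) : ℝ) * (r : ℝ) ^ (n + 1 - 1) * x ^ (n + 1) / (n + 1).factorial
      = x * ∑ n ∈ Finset.range r, (r * x) ^ n / n.factorial := by
    rw [Finset.mul_sum]
    refine Finset.sum_congr rfl fun n _ => ?_
    rw [Nat.factorial_succ, Nat.add_sub_cancel, mul_pow]
    push_cast
    have : (n : ℝ) + 1 ≠ 0 := by positivity
    field_simp
    ring
  rw [h2]
  simp
  ring

/-- Since `(n + r)! ≥ r! * r ^ n`, the exponential tail from index `r` on is at most its first term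
times a geometric series of ratio `x`. -/
lemma exp_le_sum_add_geometric (r : ℕ) {x : ℝ} (hx : 0 ≤ x) (hx1 : x < 1) :
    (1 - x) * Real.exp (r * x) ≤
      (1 - x) * ∑ n ∈ Finset.range r, (r * x) ^ n / n.factorial + (r * x) ^ r / r.factorial := by
  have hs : HasSum (fun n : ℕ => (r * x) ^ n / n.factorial) (Real.exp (r * x)) := by
    rw [Real.exp_eq_exp_ℝ]
    exact NormedSpace.exp_series_hasSum_exp' (𝕂 := ℝ) (r * x : ℝ) |>.congr_fun fun n => by
      simp [div_eq_inv_mul]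
  have hsum := hs.summable
  have h1 := hsum.sum_add_tsum_nat_add r
  rw [hs.tsum_eq] at h1
  have h2 : ∑' n : ℕ, (r * x) ^ (n + r) / ((n + r).factorial : ℝ)
      ≤ ∑' n : ℕ, (r * x) ^ r / r.factorial * x ^ n := by
    refine Summable.tsum_le_tsum (fun n => ?_) ((summable_nat_add_iff r).2 hsum)
      ((summable_geometric_of_lt_one hx hx1).mul_left _)
    have hf : (r.factorial : ℝ) * (r : ℝ) ^ n ≤ ((n + r).factorial : ℝ) := by
      have := Nat.factorial_mul_pow_le_factorial (m := r) (n := n)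
      have h3 : r.factorial * r ^ n ≤ (n + r).factorial := by
        rw [add_comm n r]
        exact le_trans (Nat.mul_le_mul_left _ (Nat.pow_le_pow_left (by omega) _)) this
      exact_mod_cast h3
    rw [div_mul_eq_mul_div, div_le_div_iff₀ (by positivity) (by positivity), pow_add, mul_pow _ _ n]
    have : 0 ≤ (r * x) ^ r * x ^ n := by positivity
    nlinarith
  rw [tsum_mul_left, tsum_geometric_of_lt_one hx hx1] at h2
  have h3 : 0 < 1 - x := by linarith
  rw [← h1, mul_add]
  have h4 := mul_le_mul_of_nonneg_left h2 h3.le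
  have h5 : (1 - x) * ((r * x) ^ r / r.factorial * (1 - x)⁻¹) = (r * x) ^ r / r.factorial := by
    field_simp
  linarith

lemma one_sub_le_poissonAdmissible (r : ℕ) {x : ℝ} (hx : 0 ≤ x) (hx1 : x < 1) :
    1 - x ≤ poissonAdmissible r 0 x := by
  rw [poissonAdmissible_zero_left]
  have h := mul_le_mul_of_nonneg_left (exp_le_sum_add_geometric r hx hx1)
    (Real.exp_pos (-(r * x))).le
  refine le_trans (le_of_eq ?_) h
  rw [Real.exp_neg]
  field_simp

/-- The partial sum is at most the exponential, and the remaining term is at most `(x * exp (1 - x))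
^ r` because `r ^ r / r! ≤ exp r`. -/
lemma poissonAdmissible_le (r : ℕ) {x : ℝ} (hx : 0 ≤ x) (hx1 : x ≤ Real.log 2) :
    poissonAdmissible r 0 x ≤ 1 - x + (Real.log 2 * Real.exp 1 / 2) ^ r := by
  have hl1 : Real.log 2 < 1 := by have := Real.log_two_lt_d9; linarith
  rw [poissonAdmissible_zero_left, mul_add]
  refine add_le_add ?_ ?_
  · have h := Real.sum_le_exp_of_nonneg (x := r * x) (by positivity) r
    have h2 : Real.exp (-(r * x)) * Real.exp (r * x) = 1 := by rw [← Real.exp_add]; simp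
    have h3 : 0 ≤ Real.exp (-(r * x)) * (1 - x) :=
      mul_nonneg (Real.exp_pos _).le (by linarith)
    nlinarith [mul_le_mul_of_nonneg_left h h3]
  · have h1 : (r : ℝ) ^ r / r.factorial ≤ Real.exp 1 ^ r := by
      have := Real.pow_div_factorial_le_exp (r : ℝ) (by positivity) r
      rwa [← Real.exp_nat_mul, mul_one]
    have h2 : Real.exp (-x) * x * Real.exp 1 ≤ Real.log 2 * Real.exp 1 / 2 := by
      have h4 : Real.exp (-x) * x ≤ Real.log 2 / 2 := by
        -- The tangent to `exp` at `log 2` gives `x * exp (-x) ≤ log 2 / 2` for `x ≤ log 2`.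
        have h5 := Real.add_one_le_exp (x - Real.log 2)
        rw [Real.exp_sub, Real.exp_log (by norm_num)] at h5
        have h6 : Real.log 2 * (x - Real.log 2 + 1) ≤ Real.log 2 * (Real.exp x / 2) :=
          mul_le_mul_of_nonneg_left h5 (Real.log_nonneg (by norm_num))
        have h7 : x ≤ Real.log 2 / 2 * Real.exp x := by nlinarith
        rw [Real.exp_neg, inv_mul_le_iff₀ (Real.exp_pos x)]
        linarith
      nlinarith [Real.exp_pos 1]
    calc Real.exp (-(r * x)) * ((r * x) ^ r / r.factorial)
        = (Real.exp (-x) * x) ^ r * ((r : ℝ) ^ r / r.factorial) := by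
          rw [mul_pow, mul_pow, ← Real.exp_nat_mul, mul_neg]; ring
      _ ≤ (Real.exp (-x) * x) ^ r * Real.exp 1 ^ r := by gcongr
      _ = (Real.exp (-x) * x * Real.exp 1) ^ r := by rw [← mul_pow]
      _ ≤ _ := pow_le_pow_left₀ (by positivity) h2 r

/-! ### The lexicographic optimum as a greedy basis -/

lemma IsLexMax.unique {E : Type*} {M : Matroid E} {succ : E → E → Prop}
    (h : IsStrictTotalOrder E succ) {S B B' : Set E}
    (hB : IsLexMax M succ S B) (hB' : IsLexMax M succ S B') : B = B' := by
  by_contra hne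
  obtain ⟨e, heB, heB', he⟩ := hB.2 B' hB'.1.1 hB'.1.2 (Ne.symm hne)
  obtain ⟨f, hfB', hfB, hf⟩ := hB'.2 B hB.1.1 hB.1.2 hne
  by_cases h1 : succ e f
  · exact heB' ((hf e h1).2 heB)
  by_cases h2 : succ f e
  · exact hfB ((he f h2).2 hfB')
  · obtain rfl := h.trichotomous e f h1 h2
    exact heB' hfB'

section Optimum

variable {E : Type*} [Finite E] {M : Matroid E} {succ : E → E → Prop}

lemma wellFounded_of_isStrictTotalOrder (h : IsStrictTotalOrder E succ) : WellFounded succ :=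
  haveI := h
  Finite.wellFounded_of_trans_of_irrefl succ

/-- The elements of `S` that are not spanned by the more valuable elements of `S`. -/
def greedyBasis (M : Matroid E) (succ : E → E → Prop) (S : Set E) : Set E :=
  {e | e ∈ S ∧ e ∉ M.closure {f | f ∈ S ∧ succ f e}}

lemma mem_closure_greedyBasis (hE : M.E = Set.univ) (h : IsStrictTotalOrder E succ) {S : Set E}
    {e : E} (he : e ∈ S) : e ∈ M.closure {f | f ∈ greedyBasis M succ S ∧ (succ f e ∨ f = e)} := by
  induction e using (wellFounded_of_isStrictTotalOrder h).induction with
  | _ e ih =>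
    by_cases heB : e ∈ greedyBasis M succ S
    · exact M.mem_closure_of_mem' ⟨heB, Or.inr rfl⟩ (by simp [hE])
    · have h1 : e ∈ M.closure {f | f ∈ S ∧ succ f e} := by
        by_contra hc
        exact heB ⟨he, hc⟩
      refine M.closure_subset_closure_of_subset_closure ?_ h1
      rintro f ⟨hfS, hfe⟩
      refine M.closure_subset_closure ?_ (ih f hfe hfS)
      rintro g ⟨hg, hgf⟩
      refine ⟨hg, Or.inl ?_⟩
      rcases hgf with hgf | rfl
      · exact h.trans _ _ _ hgf hfe
      · exact hfe

/-- The least valuable element of a circuit is spanned by the more valuable rest, so the greedy rule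
would have rejected it. -/
lemma greedyBasis_indep (hE : M.E = Set.univ) (h : IsStrictTotalOrder E succ) (S : Set E) :
    M.Indep (greedyBasis M succ S) := by
  by_contra hB
  have hD : M.Dep (greedyBasis M succ S) := ⟨hB, by simp [hE]⟩
  obtain ⟨C, hCB, hC⟩ := hD.exists_isCircuit_subset
  obtain ⟨x, hxC, hx⟩ : ∃ x ∈ C, ∀ y ∈ C, ¬ succ x y := by
    have hwf : WellFounded (fun a b => succ b a) :=
      haveI := h
      Finite.wellFounded_of_trans_of_irrefl (fun a b => succ b a)
    exact hwf.has_min C hC.nonempty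
  refine (hCB hxC).2 (M.closure_subset_closure ?_ (hC.mem_closure_sdiff_singleton_of_mem hxC))
  rintro y ⟨hyC, hyx⟩
  refine ⟨(hCB hyC).1, ?_⟩
  by_contra hc
  exact hyx (h.trichotomous y x hc (hx y hyC))

lemma isLexMax_greedyBasis (hE : M.E = Set.univ) (h : IsStrictTotalOrder E succ) (S : Set E) :
    IsLexMax M succ S (greedyBasis M succ S) := by
  refine ⟨⟨fun e he => he.1, greedyBasis_indep hE h S⟩, fun J hJS hJ hne => ?_⟩
  have hex : ({x | ¬ (x ∈ greedyBasis M succ S ↔ x ∈ J)} : Set E).Nonempty := by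
    by_contra hc
    refine hne (Set.ext fun x => ?_)
    by_contra hx
    exact hc ⟨x, fun hh => hx hh.symm⟩
  obtain ⟨x, hx, hmin⟩ := (wellFounded_of_isStrictTotalOrder h).has_min _ hex
  have hagree : ∀ f, succ f x → (f ∈ greedyBasis M succ S ↔ f ∈ J) := by
    intro f hf
    by_contra hc
    exact hmin f hc hf
  by_cases hxB : x ∈ greedyBasis M succ S
  · exact ⟨x, hxB, fun hxJ => hx (by simp [hxB, hxJ]), hagree⟩
  · have hxJ : x ∈ J := by
      by_contra hc
      exact hx (by simp [hxB, hc])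
    -- At the first disagreement `x`, the better basis elements lie in `J` and span `x`,
    -- contradicting the independence of `J`.
    exfalso
    refine hJ.notMem_closure_sdiff_of_mem hxJ (M.closure_subset_closure ?_
      (mem_closure_greedyBasis hE h (hJS hxJ)))
    rintro f ⟨hfB, hf⟩
    rcases hf with hf | rfl
    · refine ⟨(hagree f hf).1 hfB, ?_⟩
      rintro rfl
      exact h.irrefl _ hf
    · exact absurd hfB hxB

lemma opt_eq_greedyBasis (hE : M.E = Set.univ) (h : IsStrictTotalOrder E succ) (S : Set E) :
    opt M succ S = greedyBasis M succ S := by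
  ext e
  constructor
  · rintro ⟨B, hB, he⟩
    rwa [← hB.unique h (isLexMax_greedyBasis hE h S)]
  · exact fun he => ⟨_, isLexMax_greedyBasis hE h S, he⟩

lemma mem_opt_iff (hE : M.E = Set.univ) (h : IsStrictTotalOrder E succ) {S : Set E} {e : E} :
    e ∈ opt M succ S ↔ e ∈ S ∧ e ∉ M.closure {f | f ∈ S ∧ succ f e} := by
  rw [opt_eq_greedyBasis hE h]
  rfl

lemma opt_indep (hE : M.E = Set.univ) (h : IsStrictTotalOrder E succ) (S : Set E) :
    M.Indep (opt M succ S) := by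
  rw [opt_eq_greedyBasis hE h]
  exact greedyBasis_indep hE h S

lemma mem_opt_of_subset (hE : M.E = Set.univ) (h : IsStrictTotalOrder E succ) {S T : Set E} {e : E}
    (hST : S ⊆ T) (he : e ∈ opt M succ T) (heS : e ∈ S) : e ∈ opt M succ S := by
  rw [mem_opt_iff hE h] at he ⊢
  exact ⟨heS, fun hc => he.2 (M.closure_subset_closure
    (fun f (hf : f ∈ S ∧ succ f e) => show f ∈ T ∧ succ f e from ⟨hST hf.1, hf.2⟩) hc)⟩

end Optimum

/-! ### Runs of the algorithm -/

section Algorithm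

variable {E : Type*} {M : Matroid E} {succ : E → E → Prop} {t : E → unitInterval}

lemma greedyLoop_append (l₁ l₂ : List E) (A : Set E) :
    greedyLoop M succ t (l₁ ++ l₂) A = greedyLoop M succ t l₂ (greedyLoop M succ t l₁ A) := by
  induction l₁ generalizing A with
  | nil => rfl
  | cons e l ih => simp only [List.cons_append, greedyLoop, ih]

lemma subset_greedyLoop (l : List E) (A : Set E) : A ⊆ greedyLoop M succ t l A := by
  induction l generalizing A with
  | nil => exact subset_rfl
  | cons e l ih =>
    rw [greedyLoop]
    refine subset_trans ?_ (ih _)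
    split_ifs
    · exact Set.subset_insert _ _
    · exact subset_rfl

lemma greedyLoop_subset (l : List E) (A : Set E) :
    greedyLoop M succ t l A ⊆ A ∪ {f | f ∈ l ∧ IsImproving M succ t f} := by
  induction l generalizing A with
  | nil => simp [greedyLoop]
  | cons e l ih =>
    rw [greedyLoop]
    refine (ih _).trans ?_
    rintro f (hf | ⟨hf, hf'⟩)
    · split_ifs at hf with hc
      · rcases hf with rfl | hf
        · exact Or.inr ⟨by simp, hc.1⟩
        · exact Or.inl hf
      · exact Or.inl hf
    · exact Or.inr ⟨by simp [hf], hf'⟩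

lemma greedyLoop_indep (l : List E) {A : Set E} (hA : M.Indep A) :
    M.Indep (greedyLoop M succ t l A) := by
  induction l generalizing A with
  | nil => exact hA
  | cons e l ih =>
    rw [greedyLoop]
    split_ifs with hc
    · exact ih hc.2
    · exact ih hA

/-- An improving element is rejected only if the current selection spans it, so the selection spans
every improving element processed. -/
lemma mem_closure_greedyLoop (hE : M.E = Set.univ) {l : List E} {A : Set E} (hA : M.Indep A)
    {f : E} (hf : f ∈ l) (hfi : IsImproving M succ t f) :
    f ∈ M.closure (greedyLoop M succ t l A) := by
  induction l generalizing A with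
  | nil => simp at hf
  | cons e l ih =>
    rw [greedyLoop]
    rcases List.mem_cons.1 hf with rfl | hf
    · split_ifs with hc
      · exact M.mem_closure_of_mem' (subset_greedyLoop _ _ (Set.mem_insert _ _)) (by simp [hE])
      · refine M.closure_subset_closure (subset_greedyLoop _ _) ?_
        by_contra hcl
        exact hc ⟨hfi, (hA.notMem_closure_iff (by simp [hE])).1 hcl |>.1⟩
    · split_ifs with hc
      · exact ih hc.2 hf
      · exact ih hA hf

lemma mem_arrivalList [Fintype E] {p : ℝ} {e : E} : e ∈ arrivalList p t ↔ p ≤ (t e : ℝ) := by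
  simp [arrivalList]

lemma nodup_arrivalList [Fintype E] (p : ℝ) (t : E → unitInterval) : (arrivalList p t).Nodup := by
  unfold arrivalList
  exact ((List.mergeSort_perm _ _).nodup_iff).2 ((Finset.nodup_toList _).filter _)

lemma pairwise_arrivalList [Fintype E] (p : ℝ) (t : E → unitInterval) :
    (arrivalList p t).Pairwise fun e f => t e ≤ t f := by
  unfold arrivalList
  have := List.pairwise_mergeSort (le := fun e f : E => decide (t e ≤ t f))
    (fun a b c hab hbc => by simp only [decide_eq_true_eq] at *; exact hab.trans hbc)
    (fun a b => by simp; exact le_total _ _)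
    ((Finset.univ : Finset E).toList.filter (fun e => decide (p ≤ (t e : ℝ))))
  refine List.Pairwise.imp ?_ this
  intro a b hab
  simpa using hab

/-- For distinct arrival times, an element is selected by the algorithm if and only if it arrives
after the sampling phase, is improving, and is not spanned by the improving elements that arrive
after the sampling phase and before it. -/
lemma mem_greedyImproving_iff [Fintype E] (hE : M.E = Set.univ) (ht : Function.Injective t)
    {p : ℝ} {e : E} :
    e ∈ greedyImproving p M succ t ↔ p ≤ (t e : ℝ) ∧ IsImproving M succ t e ∧
      e ∉ M.closure {f | p ≤ (t f : ℝ) ∧ t f < t e ∧ IsImproving M succ t f} := by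
  by_cases hp : p ≤ (t e : ℝ)
  swap
  · simp only [hp, false_and, iff_false]
    intro he
    rcases greedyLoop_subset _ _ he with he | he
    · exact he
    · exact hp (mem_arrivalList.1 he.1)
  obtain ⟨l₁, l₂, hl⟩ := List.append_of_mem (mem_arrivalList.2 hp)
  have hnd := nodup_arrivalList p t
  have hpw := pairwise_arrivalList p t
  rw [hl] at hnd hpw
  have hnd' := List.nodup_append.1 hnd
  have hpw' := List.pairwise_append.1 hpw
  have hel₁ : e ∉ l₁ := fun h => hnd'.2.2 e h e (by simp) rfl
  have hel₂ : e ∉ l₂ := (List.nodup_cons.1 hnd'.2.1).1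
  have hmem : ∀ f, f ∈ l₁ ↔ p ≤ (t f : ℝ) ∧ t f < t e := by
    intro f
    constructor
    · intro hf
      refine ⟨mem_arrivalList.1 (by rw [hl]; simp [hf]), lt_of_le_of_ne (hpw'.2.2 f hf e (by simp)) ?_⟩
      intro heq
      exact hel₁ (ht heq ▸ hf)
    · rintro ⟨hpf, hfe⟩
      have : f ∈ arrivalList p t := mem_arrivalList.2 hpf
      rw [hl] at this
      rcases List.mem_append.1 this with h | h
      · exact h
      · exfalso
        rcases List.mem_cons.1 h with rfl | h
        · exact lt_irrefl _ hfe
        · exact absurd ((List.pairwise_cons.1 hpw'.2.1).1 f h) (not_le.2 hfe)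
  set A := greedyLoop M succ t l₁ ∅ with hAdef
  have hA : M.Indep A := greedyLoop_indep _ M.empty_indep
  have hJ : {f | p ≤ (t f : ℝ) ∧ t f < t e ∧ IsImproving M succ t f}
      = {f | f ∈ l₁ ∧ IsImproving M succ t f} := by
    ext f
    simp [hmem, and_assoc]
  have hcl : M.closure {f | p ≤ (t f : ℝ) ∧ t f < t e ∧ IsImproving M succ t f} = M.closure A := by
    rw [hJ]
    apply subset_antisymm
    · refine M.closure_subset_closure_of_subset_closure ?_
      rintro f ⟨hf, hfi⟩
      exact mem_closure_greedyLoop hE M.empty_indep hf hfi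
    · refine M.closure_subset_closure ?_
      have := greedyLoop_subset (M := M) (succ := succ) (t := t) l₁ ∅
      simpa using this
  have heA : e ∉ A := by
    intro h
    rcases greedyLoop_subset _ _ h with h | h
    · exact h
    · exact hel₁ h.1
  rw [hcl]
  have hind : M.Indep (insert e A) ↔ e ∉ M.closure A := by
    rw [hA.notMem_closure_iff_of_notMem heA (by simp [hE])]
  simp only [hp, true_and]
  unfold greedyImproving
  rw [hl, greedyLoop_append, ← hAdef, greedyLoop, hind]
  constructor
  · intro h
    by_contra hc
    rw [if_neg hc] at h
    rcases greedyLoop_subset _ _ h with h | h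
    · exact heA h
    · exact hel₂ h.1
  · intro h
    rw [if_pos h]
    exact subset_greedyLoop _ _ (Set.mem_insert _ _)

end Algorithm

/-! ### Random arrival times -/

lemma measurableSet_forall_lt {E : Type*} (S : Finset E) (y : ℝ) :
    MeasurableSet {t : E → unitInterval | ∀ f ∈ S, (t f : ℝ) < y} := by
  have : {t : E → unitInterval | ∀ f ∈ S, (t f : ℝ) < y}
      = ⋂ f ∈ S, {t : E → unitInterval | (t f : ℝ) < y} := by
    ext t; simp
  rw [this]
  exact Finset.measurableSet_biInter _ fun f _ =>
    measurableSet_lt (measurable_subtype_coe.comp (measurable_pi_apply f)) measurable_const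

section ArrivalTimes

variable {E : Type*} [Fintype E]

instance : IsProbabilityMeasure (arrivalLaw E) := by
  unfold arrivalLaw
  infer_instance

/-- Resampling one coordinate preserves the law. This is the form in which Fubini's theorem isolates
the arrival time of a single element. -/
lemma measurePreserving_update [DecidableEq E] (f : E) :
    MeasurePreserving
      (fun p : unitInterval × (E → unitInterval) => Function.update p.2 f p.1)
      (volume.prod (arrivalLaw E)) (arrivalLaw E) := by
  have hm : Measurable
      (fun p : unitInterval × (E → unitInterval) => Function.update p.2 f p.1) := by
    refine measurable_pi_iff.2 fun i => ?_
    by_cases hi : i = f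
    · subst hi
      simpa using measurable_fst
    · simp only [Function.update_of_ne hi]
      exact (measurable_pi_apply i).comp measurable_snd
  refine ⟨hm, ?_⟩
  symm
  refine Measure.pi_eq fun s hs => ?_
  rw [Measure.map_apply hm (MeasurableSet.univ_pi hs)]
  have : (fun p : unitInterval × (E → unitInterval) => Function.update p.2 f p.1) ⁻¹'
      (Set.univ.pi s) = s f ×ˢ Set.univ.pi (Function.update s f Set.univ) := by
    ext ⟨y, t⟩
    simp only [Set.mem_preimage, Set.mem_pi, Set.mem_univ, true_implies, Set.mem_prod]
    constructor
    · intro h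
      refine ⟨by simpa using h f, fun i => ?_⟩
      by_cases hi : i = f
      · subst hi; simp
      · simpa [Function.update_of_ne hi] using h i
    · rintro ⟨h1, h2⟩ i
      by_cases hi : i = f
      · subst hi; simpa using h1
      · simpa [Function.update_of_ne hi] using h2 i
  rw [this, Measure.prod_prod, arrivalLaw, Measure.pi_pi,
    ← Finset.mul_prod_erase Finset.univ (fun i => volume (s i)) (Finset.mem_univ f),
    ← Finset.mul_prod_erase Finset.univ (fun i => volume (Function.update s f Set.univ i))
      (Finset.mem_univ f)]
  simp only [Function.update_self, measure_univ, one_mul]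
  congr 1
  refine Finset.prod_congr rfl fun i hi => ?_
  rw [Function.update_of_ne (Finset.ne_of_mem_erase hi)]

lemma arrivalLaw_real_eq_integral [DecidableEq E] (f : E) {A : Set (E → unitInterval)}
    (hA : MeasurableSet A) :
    (arrivalLaw E).real A =
      ∫ y : unitInterval, (arrivalLaw E).real {t | Function.update t f y ∈ A} := by
  have hm := (measurePreserving_update f).measurable hA
  have h := (measurePreserving_update f).measure_preimage hA.nullMeasurableSet
  rw [Measure.real, ← h, Measure.prod_apply hm]
  simp only [Measure.real]
  rw [integral_toReal]
  · rfl
  · exact (measurable_measure_prodMk_left hm).aemeasurable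
  · exact Filter.Eventually.of_forall fun y => measure_lt_top _ _

lemma ae_injective : ∀ᵐ t ∂(arrivalLaw E), Function.Injective t := by
  classical
  have h : ∀ f g : E, ∀ᵐ t ∂(arrivalLaw E), t f = t g → f = g := by
    intro f g
    by_cases hfg : f = g
    · simp [hfg]
    · have hA : MeasurableSet {t : E → unitInterval | t f = t g} :=
        measurableSet_eq_fun (measurable_pi_apply f) (measurable_pi_apply g)
      have h0 : (arrivalLaw E).real {t : E → unitInterval | t f = t g} = 0 := by
        rw [arrivalLaw_real_eq_integral f hA]
        have : ∀ y : unitInterval, (arrivalLaw E).real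
            {t | Function.update t f y ∈ {t : E → unitInterval | t f = t g}} = 0 := by
          intro y
          have he : {t | Function.update t f y ∈ {t : E → unitInterval | t f = t g}}
              = Function.eval g ⁻¹' ({y} : Set unitInterval) := by
            ext t
            simp [Function.update_of_ne (Ne.symm hfg), eq_comm]
          rw [he, Measure.real, arrivalLaw,
            (measurePreserving_eval (fun _ : E => (volume : Measure unitInterval)) g).measure_preimage
              (measurableSet_singleton y).nullMeasurableSet]
          simp
        rw [integral_congr_ae (Filter.Eventually.of_forall this), integral_zero]
      rw [measureReal_eq_zero_iff] at h0
      refine (ae_iff.2 ?_)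
      simpa [hfg] using h0
  filter_upwards [ae_all_iff.2 fun f => ae_all_iff.2 (h f)] with t ht
  exact fun f g hfg => ht f g hfg

/-- There are only finitely many patterns of arrival order and lateness, so every set of patterns is
measurable. -/
lemma measurableSet_of_pattern (Φ : (E → E → Prop) → (E → Prop) → Prop) :
    MeasurableSet {t : E → unitInterval |
      Φ (fun f g => t f ≤ t g) (fun f => (1 / 2 : ℝ) ≤ t f)} := by
  have h1 : Measurable fun t : E → unitInterval => fun f g => t f ≤ t g := by
    refine measurable_pi_iff.2 fun f => measurable_pi_iff.2 fun g => ?_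
    exact measurableSet_setOfPred.1 (measurableSet_le (measurable_pi_apply f) (measurable_pi_apply g))
  have h2 : Measurable fun t : E → unitInterval => fun f => (1 / 2 : ℝ) ≤ t f := by
    refine measurable_pi_iff.2 fun f => ?_
    exact measurableSet_setOfPred.1 (measurableSet_le measurable_const
      (measurable_subtype_coe.comp (measurable_pi_apply f)))
  have h3 : MeasurableSet {p : (E → E → Prop) × (E → Prop) | Φ p.1 p.2} :=
    (Set.toFinite _).measurableSet
  exact (h1.prodMk h2) h3

lemma arrivalLaw_real_forall_lt (S : Finset E) {y : ℝ} (h0 : 0 ≤ y) (h1 : y ≤ 1) :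
    (arrivalLaw E).real {t | ∀ f ∈ S, (t f : ℝ) < y} = y ^ S.card := by
  have : {t : E → unitInterval | ∀ f ∈ S, (t f : ℝ) < y}
      = (S : Set E).pi fun _ => Set.Iio (⟨y, h0, h1⟩ : unitInterval) := by
    ext t
    simp [Set.mem_pi, ← Subtype.coe_lt_coe]
  rw [this, Measure.real, arrivalLaw, Measure.pi_pi_finset]
  simp only [unitInterval.volume_Iio, Finset.prod_const, ENNReal.toReal_pow]
  rw [ENNReal.toReal_ofReal h0]

lemma integral_unitInterval_indicator {φ : ℝ → ℝ} {a x : ℝ} (ha : 0 ≤ a) (hax : a ≤ x)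
    (hx : x ≤ 1) :
    ∫ y : unitInterval, (Set.Ico a x).indicator φ (y : ℝ) = ∫ y in a..x, φ y := by
  have h := unitInterval.measurePreserving_coe.integral_comp unitInterval.measurableEmbedding_coe
    ((Set.Ico a x).indicator φ)
  rw [h, setIntegral_indicator measurableSet_Ico, intervalIntegral.integral_of_le hax,
    ← integral_Ico_eq_integral_Ioc]
  congr 2
  ext y
  simp only [Set.mem_inter_iff, Set.mem_Ico, unitInterval, Set.mem_Icc]
  constructor
  · exact fun h => h.2
  · exact fun h => ⟨⟨by linarith [h.1], by linarith [h.2]⟩, h⟩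

/-- Decomposition of an event on the arrival times of `S` according to the last arrival. -/
lemma arrivalLaw_real_last_arrival [DecidableEq E] (S : Finset E) {P : (E → unitInterval) → Prop}
    {R : E → (E → unitInterval) → Prop}
    (hR : ∀ f, MeasurableSet {t | R f t})
    (hupd : ∀ f ∈ S, ∀ t y, R f (Function.update t f y) ↔ R f t)
    (hstep : ∀ f ∈ S, ∀ t : E → unitInterval, (1 / 2 : ℝ) ≤ t f →
      (∀ g ∈ S.erase f, t g < t f) → (P t ↔ R f t))
    {x : ℝ} (hx : 1 / 2 ≤ x) (hx1 : x ≤ 1) :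
    (arrivalLaw E).real {t | (∀ f ∈ S, (t f : ℝ) < x) ∧ P t} =
      (arrivalLaw E).real {t | (∀ f ∈ S, (t f : ℝ) < 1 / 2) ∧ P t} +
        ∑ f ∈ S, ∫ y in (1 / 2 : ℝ)..x,
          (arrivalLaw E).real {t | (∀ g ∈ S.erase f, (t g : ℝ) < y) ∧ R f t} := by
  -- `B f`: the last arrival of `S` is `f`, it falls in `[1/2, x)`, and the residual event `R f`
  -- holds. Up to ties these events and the case with no late arrival partition the event.
  set B : E → Set (E → unitInterval) := fun f =>
    {t | ((1 / 2 : ℝ) ≤ t f ∧ (t f : ℝ) < x) ∧ (∀ g ∈ S.erase f, t g < t f) ∧ R f t} with hB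
  have hval : ∀ f : E, Measurable fun t : E → unitInterval => (t f : ℝ) := fun f =>
    measurable_subtype_coe.comp (measurable_pi_apply f)
  have hBm : ∀ f, MeasurableSet (B f) := by
    intro f
    refine ((measurableSet_le measurable_const (hval f)).inter
      (measurableSet_lt (hval f) measurable_const)).inter (MeasurableSet.inter ?_ (hR f))
    have : {t : E → unitInterval | ∀ g ∈ S.erase f, t g < t f}
        = ⋂ g ∈ S.erase f, {t : E → unitInterval | t g < t f} := by
      ext t; simp
    have h2 : MeasurableSet {t : E → unitInterval | ∀ g ∈ S.erase f, t g < t f} := by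
      rw [this]
      exact Finset.measurableSet_biInter _ fun g _ =>
        measurableSet_lt (measurable_pi_apply g) (measurable_pi_apply f)
    exact h2
  have hae : {t | (∀ f ∈ S, (t f : ℝ) < x) ∧ P t} =ᵐ[arrivalLaw E]
      ({t | (∀ f ∈ S, (t f : ℝ) < 1 / 2) ∧ P t} ∪ ⋃ f ∈ S, B f : Set (E → unitInterval)) := by
    refine Filter.eventuallyEq_set.2 ?_
    filter_upwards [ae_injective] with t ht
    simp only [Set.mem_union, Set.mem_iUnion, exists_prop, hB, Set.mem_ofPred_eq]
    constructor
    · rintro ⟨h1, h2⟩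
      by_cases hall : ∀ f ∈ S, (t f : ℝ) < 1 / 2
      · exact Or.inl ⟨hall, h2⟩
      · right
        push Not at hall
        obtain ⟨g, hg, hg2⟩ := hall
        obtain ⟨f, hf, hmax⟩ := S.exists_max_image t ⟨g, hg⟩
        have h3 : (1 / 2 : ℝ) ≤ t f := hg2.trans (hmax g hg)
        have h4 : ∀ g ∈ S.erase f, t g < t f := fun g hg =>
          lt_of_le_of_ne (hmax g (Finset.mem_of_mem_erase hg))
            (fun h => Finset.ne_of_mem_erase hg (ht h))
        exact ⟨f, hf, ⟨h3, h1 f hf⟩, h4, (hstep f hf t h3 h4).1 h2⟩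
    · rintro (⟨h1, h2⟩ | ⟨f, hf, ⟨h1, h2⟩, h3, h4⟩)
      · exact ⟨fun f hf => (h1 f hf).trans_le hx, h2⟩
      · refine ⟨fun g hg => ?_, (hstep f hf t h1 h3).2 h4⟩
        by_cases hgf : g = f
        · rwa [hgf]
        · exact lt_trans (h3 g (Finset.mem_erase.2 ⟨hgf, hg⟩)) h2
  have hdisj : Disjoint {t : E → unitInterval | (∀ f ∈ S, (t f : ℝ) < 1 / 2) ∧ P t}
      (⋃ f ∈ S, B f) := by
    rw [Set.disjoint_left]
    rintro t ⟨h1, _⟩ h2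
    simp only [Set.mem_iUnion, exists_prop] at h2
    obtain ⟨f, hf, ⟨h3, _⟩, _⟩ := h2
    exact absurd (h1 f hf) (not_lt.2 h3)
  have hpd : Set.PairwiseDisjoint (S : Set E) B := by
    intro f hf g hg hfg
    refine Set.disjoint_left.2 ?_
    rintro t ⟨_, h1, _⟩ ⟨_, h2, _⟩
    exact lt_asymm (h1 g (Finset.mem_erase.2 ⟨hfg.symm, hg⟩)) (h2 f (Finset.mem_erase.2 ⟨hfg, hf⟩))
  rw [measureReal_congr hae, measureReal_union hdisj
    (Finset.measurableSet_biUnion _ fun f _ => hBm f) (measure_ne_top _ _) (measure_ne_top _ _),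
    measureReal_biUnion_finset hpd (fun f _ => hBm f)]
  congr 1
  refine Finset.sum_congr rfl fun f hf => ?_
  rw [arrivalLaw_real_eq_integral f (hBm f),
    ← integral_unitInterval_indicator (by norm_num) hx hx1]
  refine integral_congr_ae (Filter.Eventually.of_forall fun y => ?_)
  simp only [Set.indicator_apply, Set.mem_Ico]
  have hne : ∀ g ∈ S.erase f, ∀ t : E → unitInterval, Function.update t f y g = t g :=
    fun g hg t => Function.update_of_ne (Finset.ne_of_mem_erase hg) _ _
  split_ifs with hy
  · congr 1
    ext t
    simp only [hB, Set.mem_ofPred_eq, Function.update_self, hy, and_self, true_and,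
      hupd f hf t y]
    refine and_congr_left fun _ => forall₂_congr fun g hg => ?_
    rw [hne g hg t]
    exact Subtype.coe_lt_coe.symm
  · have : {t | Function.update t f y ∈ B f} = ∅ := by
      ext t
      simp only [hB, Set.mem_ofPred_eq, Function.update_self, Set.mem_empty_iff_false, iff_false]
      exact fun h => hy h.1
    rw [this]
    simp

end ArrivalTimes

/-! ### Comparison principle for the last-arrival recursion -/

/-- A subsolution stays below the solution: by induction on `S` its derivative is at most that of
`Q`, and it starts below at 1/2. The first alternative of `hW` admits pairs where the bound is known
directly. -/
lemma le_of_last_arrival_recursion {E σ : Type*} [DecidableEq E] {step : σ → Finset E → E → σ}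
    {Q W : σ → Finset E → ℝ → ℝ}
    (hQ : ∀ s S, ∀ x ∈ Set.Icc (1 / 2 : ℝ) 1, Q s S x =
      Q s S (1 / 2) + ∑ f ∈ S, ∫ y in (1 / 2 : ℝ)..x, Q (step s S f) (S.erase f) y)
    (hQi : ∀ s S, IntegrableOn (Q s S) (Set.Icc (1 / 2) 1))
    (hW : ∀ s S, (∀ x ∈ Set.Icc (1 / 2 : ℝ) 1, W s S x ≤ Q s S x) ∨
      (W s S (1 / 2) ≤ Q s S (1 / 2) ∧ ∃ d : ℝ → ℝ, ∀ x ∈ Set.Icc (1 / 2 : ℝ) 1,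
        HasDerivAt (W s S) (d x) x ∧ d x ≤ ∑ f ∈ S, W (step s S f) (S.erase f) x))
    (S : Finset E) (s : σ) {x : ℝ} (hx : x ∈ Set.Icc (1 / 2 : ℝ) 1) : W s S x ≤ Q s S x := by
  induction S using Finset.strongInduction generalizing s x with
  | _ S ih =>
    rcases hW s S with h | ⟨h0, d, hd⟩
    · exact h x hx
    · have hsub : Set.Icc (1 / 2) x ⊆ Set.Icc (1 / 2 : ℝ) 1 := Set.Icc_subset_Icc_right hx.2
      have hint : ∀ f ∈ S, IntegrableOn (Q (step s S f) (S.erase f)) (Set.Icc (1 / 2) x) :=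
        fun f _ => (hQi _ _).mono_set hsub
      have key := intervalIntegral.sub_le_integral_of_hasDeriv_right_of_le (g := W s S) (g' := d)
        (φ := fun y => ∑ f ∈ S, Q (step s S f) (S.erase f) y) hx.1
        (fun y hy => (hd y (hsub hy)).1.continuousAt.continuousWithinAt)
        (fun y hy => (hd y (hsub (Set.Ioo_subset_Icc_self hy))).1.hasDerivWithinAt)
        (integrable_finsetSum _ hint)
        (fun y hy => (hd y (hsub (Set.Ioo_subset_Icc_self hy))).2.trans
          (Finset.sum_le_sum fun f hf =>
            ih _ (Finset.erase_ssubset hf) _ (hsub (Set.Ioo_subset_Icc_self hy))))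
      rw [intervalIntegral.integral_finsetSum] at key
      · rw [hQ s S x hx]
        linarith
      · intro f hf
        rw [intervalIntegrable_iff_integrableOn_Icc_of_le hx.1]
        exact hint f hf

lemma last_arrival_recursion_le {E σ : Type*} [DecidableEq E] {step : σ → Finset E → E → σ}
    {Q W : σ → Finset E → ℝ → ℝ}
    (hQ : ∀ s S, ∀ x ∈ Set.Icc (1 / 2 : ℝ) 1, Q s S x =
      Q s S (1 / 2) + ∑ f ∈ S, ∫ y in (1 / 2 : ℝ)..x, Q (step s S f) (S.erase f) y)
    (hQi : ∀ s S, IntegrableOn (Q s S) (Set.Icc (1 / 2) 1))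
    (hW : ∀ s S, (∀ x ∈ Set.Icc (1 / 2 : ℝ) 1, Q s S x ≤ W s S x) ∨
      (Q s S (1 / 2) ≤ W s S (1 / 2) ∧ ∃ d : ℝ → ℝ, ∀ x ∈ Set.Icc (1 / 2 : ℝ) 1,
        HasDerivAt (W s S) (d x) x ∧ ∑ f ∈ S, W (step s S f) (S.erase f) x ≤ d x))
    (S : Finset E) (s : σ) {x : ℝ} (hx : x ∈ Set.Icc (1 / 2 : ℝ) 1) : Q s S x ≤ W s S x := by
  have := le_of_last_arrival_recursion (step := step) (Q := fun s S x => -Q s S x)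
    (W := fun s S x => -W s S x) (fun s S x hx => ?_) (fun s S => (hQi s S).neg) (fun s S => ?_) S s hx
  · linarith
  · simp only [intervalIntegral.integral_neg, Finset.sum_neg_distrib]
    rw [hQ s S x hx]
    ring
  · rcases hW s S with h | ⟨h0, d, hd⟩
    · exact Or.inl fun x hx => neg_le_neg (h x hx)
    · refine Or.inr ⟨neg_le_neg h0, fun x => -d x, fun x hx => ⟨(hd x hx).1.neg, ?_⟩⟩
      simp only [Finset.sum_neg_distrib]
      exact neg_le_neg (hd x hx).2

/-! ### Backward exploration of the arrivals -/

section Exploration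

variable {E : Type*}

open Classical in
/-- The letter multiplicities produced by the elements of `S` that satisfy `late`: the element `f`
produces the letter `lab T f`, where `T` consists of the elements `g` of `S` with `le g f`. -/
noncomputable def letterCount (lab : Finset E → E → ℕ) (le : E → E → Prop) (late : E → Prop)
    (S : Finset E) : ℕ → ℕ :=
  fun l => (S.filter fun f => late f ∧ lab (S.filter fun g => le g f) f = l).card

/-- The event followed by the backward exploration of the arrivals of `S`. In the state `none`, the
element `e` has not been explored yet, and its predecessors have to produce admissible letters. In
the state `some c`, the letters explored so far have multiplicities `c`. -/
noncomputable def Outcome (r : ℕ) (lab : Finset E → E → ℕ) (e : E) (s : Option (ℕ → ℕ))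
    (S : Finset E) (le : E → E → Prop) (late : E → Prop) : Prop :=
  open Classical in
  match s with
  | none => e ∈ S ∧ late e ∧ Admissible r (letterCount lab le late (S.filter fun f => ¬ le e f))
  | some c => Admissible r (c + letterCount lab le late S)

open Classical in
/-- The state after the exploration of the last arrival `f` of `S`. -/
noncomputable def nextState (lab : Finset E → E → ℕ) (e : E) (s : Option (ℕ → ℕ)) (S : Finset E)
    (f : E) : Option (ℕ → ℕ) :=
  match s with
  | none => if f = e then some 0 else none
  | some c => some (c + Pi.single (lab S f) 1)

/-- The probability that all the elements of `S` arrive before time `x` and that the event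
`Outcome` holds. -/
noncomputable def outcomeProb [Fintype E] (r : ℕ) (lab : Finset E → E → ℕ) (e : E)
    (s : Option (ℕ → ℕ)) (S : Finset E) (x : ℝ) : ℝ :=
  (arrivalLaw E).real {t | (∀ f ∈ S, (t f : ℝ) < x) ∧
    Outcome r lab e s S (fun f g => t f ≤ t g) (fun f => (1 / 2 : ℝ) ≤ t f)}

lemma letterCount_congr {lab : Finset E → E → ℕ} {le le' : E → E → Prop} {late late' : E → Prop}
    {S : Finset E} (hle : ∀ f ∈ S, ∀ g ∈ S, le f g ↔ le' f g)
    (hlate : ∀ f ∈ S, late f ↔ late' f) :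
    letterCount lab le late S = letterCount lab le' late' S := by
  classical
  funext l
  unfold letterCount
  congr 1
  refine Finset.filter_congr fun f hf => ?_
  rw [hlate f hf, Finset.filter_congr (q := fun g => le' g f) fun g hg => hle g hg f hf]

lemma letterCount_eq_zero {lab : Finset E → E → ℕ} {le : E → E → Prop} {late : E → Prop}
    {S : Finset E} (h : ∀ f ∈ S, ¬ late f) : letterCount lab le late S = 0 := by
  classical
  funext l
  simp only [letterCount, Pi.zero_apply, Finset.card_eq_zero]
  exact Finset.filter_eq_empty_iff.2 fun f hf hc => h f hf hc.1

/-- The last arrival `f` sees all of `S`, while the letters of the earlier elements do not involve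
`f`. -/
lemma letterCount_erase [DecidableEq E] {lab : Finset E → E → ℕ} {le : E → E → Prop}
    {late : E → Prop} {S : Finset E} {f : E} (hf : f ∈ S) (hlate : late f) (hff : le f f)
    (h : ∀ g ∈ S.erase f, le g f ∧ ¬ le f g) :
    letterCount lab le late S =
      letterCount lab le late (S.erase f) + Pi.single (lab S f) 1 := by
  classical
  funext l
  have h1 : S.filter (fun g => le g f) = S := by
    refine Finset.filter_true_of_mem fun g hg => ?_
    by_cases hgf : g = f
    · rwa [hgf]
    · exact (h g (Finset.mem_erase.2 ⟨hgf, hg⟩)).1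
  have h2 : ∀ g ∈ S.erase f, S.filter (fun k => le k g) = (S.erase f).filter (fun k => le k g) := by
    intro g hg
    ext k
    simp only [Finset.mem_filter, Finset.mem_erase]
    constructor
    · rintro ⟨h3, h4⟩
      refine ⟨⟨?_, h3⟩, h4⟩
      rintro rfl
      exact (h g hg).2 h4
    · exact fun h3 => ⟨h3.1.2, h3.2⟩
  simp only [letterCount, Pi.add_apply]
  rw [← Finset.card_filter_add_card_filter_not (s := S.filter _) (fun g => g ≠ f)]
  congr 1
  · congr 1
    ext g
    simp only [Finset.mem_filter, Finset.mem_erase]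
    constructor
    · rintro ⟨⟨hg, hl, hlab⟩, hgf⟩
      exact ⟨⟨hgf, hg⟩, hl, by rw [← h2 g (Finset.mem_erase.2 ⟨hgf, hg⟩)]; exact hlab⟩
    · rintro ⟨⟨hgf, hg⟩, hl, hlab⟩
      exact ⟨⟨hg, hl, by rw [h2 g (Finset.mem_erase.2 ⟨hgf, hg⟩)]; exact hlab⟩, hgf⟩
  · by_cases hl : lab S f = l
    · subst hl
      rw [Pi.single_eq_same, Finset.card_eq_one]
      refine ⟨f, ?_⟩
      ext g
      simp only [Finset.mem_filter, Finset.mem_singleton, not_not]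
      constructor
      · exact fun h3 => h3.2
      · rintro rfl
        exact ⟨⟨hf, hlate, by rw [h1]⟩, rfl⟩
    · rw [Pi.single_eq_of_ne (Ne.symm hl), Finset.card_eq_zero]
      refine Finset.filter_eq_empty_iff.2 ?_
      intro g hg hgf
      simp only [not_not] at hgf
      subst hgf
      rw [Finset.mem_filter, h1] at hg
      exact hl hg.2.2

/-- The Markov property of the exploration: arrivals after `e` are discarded, `e` starts an empty
count, and every further arrival adds its letter. -/
lemma outcome_erase [DecidableEq E] {r : ℕ} {lab : Finset E → E → ℕ} {e : E}
    (s : Option (ℕ → ℕ)) {le : E → E → Prop}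
    {late : E → Prop} {S : Finset E} {f : E} (hf : f ∈ S) (hlate : late f) (hff : le f f)
    (h : ∀ g ∈ S.erase f, le g f ∧ ¬ le f g) :
    Outcome r lab e s S le late ↔
      Outcome r lab e (nextState lab e s S f) (S.erase f) le late := by
  classical
  match s with
  | some c =>
    simp only [Outcome, nextState]
    rw [letterCount_erase hf hlate hff h, add_assoc, add_comm (Pi.single _ _)]
  | none =>
    by_cases hfe : f = e
    · subst hfe
      have h1 : (S.filter fun g => ¬ le f g) = S.erase f := by
        ext g
        simp only [Finset.mem_filter, Finset.mem_erase]
        constructor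
        · rintro ⟨hg, hfg⟩
          refine ⟨?_, hg⟩
          rintro rfl
          exact hfg hff
        · rintro ⟨hgf, hg⟩
          exact ⟨hg, (h g (Finset.mem_erase.2 ⟨hgf, hg⟩)).2⟩
      simp only [Outcome, nextState, if_true, zero_add, hf, hlate, true_and]
      rw [← h1]
    · simp only [Outcome, nextState, Finset.mem_erase, ne_eq, Ne.symm hfe,
        not_false_eq_true, true_and, hfe]
      refine and_congr_right fun heS => ?_
      have h1 : (S.filter fun g => ¬ le e g) = (S.erase f).filter fun g => ¬ le e g := by
        ext g
        simp only [Finset.mem_filter, Finset.mem_erase]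
        constructor
        · rintro ⟨hg, heg⟩
          refine ⟨⟨?_, hg⟩, heg⟩
          rintro rfl
          exact heg (h e (Finset.mem_erase.2 ⟨Ne.symm hfe, heS⟩)).1
        · exact fun h3 => ⟨h3.1.2, h3.2⟩
      rw [h1]

lemma outcome_congr {r : ℕ} {lab : Finset E → E → ℕ} {e : E} (s : Option (ℕ → ℕ))
    {le le' : E → E → Prop} {late late' : E → Prop}
    {S : Finset E} (hle : ∀ f ∈ S, ∀ g ∈ S, le f g ↔ le' f g)
    (hlate : ∀ f ∈ S, late f ↔ late' f) :
    Outcome r lab e s S le late ↔ Outcome r lab e s S le' late' := by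
  classical
  match s with
  | some c => simp only [Outcome, letterCount_congr hle hlate]
  | none =>
    simp only [Outcome]
    refine and_congr_right fun heS => ?_
    rw [hlate e heS, Finset.filter_congr fun g hg => not_congr (hle e heS g hg)]
    refine and_congr_right fun _ => ?_
    rw [letterCount_congr (fun f hf g hg => hle f (Finset.mem_of_mem_filter f hf) g
      (Finset.mem_of_mem_filter g hg)) (fun f hf => hlate f (Finset.mem_of_mem_filter f hf))]

variable [Fintype E]

lemma outcomeProb_eq [DecidableEq E] (r : ℕ) (lab : Finset E → E → ℕ) (e : E)
    (s : Option (ℕ → ℕ)) (S : Finset E) {x : ℝ} (hx : x ∈ Set.Icc (1 / 2 : ℝ) 1) :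
    outcomeProb r lab e s S x = outcomeProb r lab e s S (1 / 2) +
      ∑ f ∈ S, ∫ y in (1 / 2 : ℝ)..x, outcomeProb r lab e (nextState lab e s S f) (S.erase f) y := by
  refine arrivalLaw_real_last_arrival S
    (P := fun t => Outcome r lab e s S (fun f g => t f ≤ t g) (fun f => (1 / 2 : ℝ) ≤ t f))
    (R := fun f t => Outcome r lab e (nextState lab e s S f) (S.erase f) (fun f g => t f ≤ t g)
      (fun f => (1 / 2 : ℝ) ≤ t f)) (fun f => measurableSet_of_pattern _) ?_ ?_ hx.1 hx.2
  · intro f hf t y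
    have h : ∀ g ∈ S.erase f, Function.update t f y g = t g := fun g hg =>
      Function.update_of_ne (Finset.ne_of_mem_erase hg) _ _
    exact outcome_congr _ (fun g hg k hk => by rw [h g hg, h k hk]) (fun g hg => by rw [h g hg])
  · intro f hf t h1 h2
    exact outcome_erase s hf h1 le_rfl fun g hg => ⟨(h2 g hg).le, not_le.2 (h2 g hg)⟩

lemma outcomeProb_mono (r : ℕ) (lab : Finset E → E → ℕ) (e : E)
    (s : Option (ℕ → ℕ)) (S : Finset E) : Monotone (outcomeProb r lab e s S) :=
  fun _ _ hxy => measureReal_mono (fun _ ht => ⟨fun f hf => (ht.1 f hf).trans_le hxy, ht.2⟩)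

lemma outcomeProb_nonneg (r : ℕ) (lab : Finset E → E → ℕ) (e : E)
    (s : Option (ℕ → ℕ)) (S : Finset E) (x : ℝ) : 0 ≤ outcomeProb r lab e s S x :=
  measureReal_nonneg

lemma outcomeProb_le (r : ℕ) (lab : Finset E → E → ℕ) (e : E)
    (s : Option (ℕ → ℕ)) (S : Finset E) {x : ℝ} (hx : x ∈ Set.Icc (1 / 2 : ℝ) 1) :
    outcomeProb r lab e s S x ≤ x ^ S.card := by
  rw [← arrivalLaw_real_forall_lt S (by linarith [hx.1]) hx.2]
  exact measureReal_mono (fun _ ht => ht.1)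

lemma integrableOn_outcomeProb (r : ℕ) (lab : Finset E → E → ℕ) (e : E)
    (s : Option (ℕ → ℕ)) (S : Finset E) :
    IntegrableOn (outcomeProb r lab e s S) (Set.Icc (1 / 2) 1) :=
  ((outcomeProb_mono r lab e s S).monotoneOn _).integrableOn_isCompact isCompact_Icc

lemma outcomeProb_some_half (r : ℕ) (lab : Finset E → E → ℕ) (e : E) (c : ℕ → ℕ) (S : Finset E) :
    outcomeProb r lab e (some c) S (1 / 2) = (1 / 2) ^ S.card * wordCount r 0 c := by
  have h : ∀ t : E → unitInterval, (∀ f ∈ S, (t f : ℝ) < 1 / 2) →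
      (Outcome r lab e (some c) S (fun f g => t f ≤ t g) (fun f => (1 / 2 : ℝ) ≤ t f) ↔
        Admissible r c) := by
    intro t ht
    simp only [Outcome]
    rw [letterCount_eq_zero fun f hf => not_le.2 (ht f hf), add_zero]
  have h2 : {t : E → unitInterval | (∀ f ∈ S, (t f : ℝ) < 1 / 2) ∧
      Outcome r lab e (some c) S (fun f g => t f ≤ t g) (fun f => (1 / 2 : ℝ) ≤ t f)}
      = {t | (∀ f ∈ S, (t f : ℝ) < 1 / 2) ∧ Admissible r c} := by
    ext t
    exact and_congr_right fun ht => h t ht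
  rw [outcomeProb, h2]
  by_cases hc : Admissible r c
  · simp only [hc, and_true, wordCount, if_true, mul_one]
    exact arrivalLaw_real_forall_lt S (by norm_num) (by norm_num)
  · simp [hc, wordCount]

lemma outcomeProb_none_half (r : ℕ) (lab : Finset E → E → ℕ) (e : E) (S : Finset E) :
    outcomeProb r lab e none S (1 / 2) = 0 := by
  have : {t : E → unitInterval | (∀ f ∈ S, (t f : ℝ) < 1 / 2) ∧
      Outcome r lab e none S (fun f g => t f ≤ t g) (fun f => (1 / 2 : ℝ) ≤ t f)} = ∅ := by
    ext t
    simp only [Outcome, Set.mem_ofPred_eq, Set.mem_empty_iff_false, iff_false]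
    exact fun h => absurd (h.1 e h.2.1) (not_lt.2 h.2.2.1)
  rw [outcomeProb, this, measureReal_empty]

lemma outcomeProb_none_of_notMem (r : ℕ) (lab : Finset E → E → ℕ) {e : E} {S : Finset E}
    (he : e ∉ S) (x : ℝ) : outcomeProb r lab e none S x = 0 := by
  simp [outcomeProb, Outcome, he]

end Exploration

/-! ### Comparison with Poisson letters -/

section Bounds


lemma hasDerivAt_log_two_mul {x : ℝ} (hx : 0 < x) :
    HasDerivAt (fun x => Real.log (2 * x)) (1 / x) x := by
  refine (((hasDerivAt_id x).const_mul 2).log (by simp; exact hx.ne')).congr_deriv ?_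
  simp only [id]
  field_simp

/-- This is the antiderivative of `1 - log (2 * x)` vanishing at 1/2, with value `1 - log 2` at 1.
-/
lemma hasDerivAt_expected_slack {x : ℝ} (hx : 0 < x) :
    HasDerivAt (fun x => 2 * x - 1 - x * Real.log (2 * x)) (1 - Real.log (2 * x)) x := by
  refine ((((hasDerivAt_id x).const_mul 2).sub_const 1).sub
    ((hasDerivAt_id x).mul (hasDerivAt_log_two_mul hx))).congr_deriv ?_
  simp only [id]
  field_simp
  ring

lemma log_two_mul_mem {x : ℝ} (hx : x ∈ Set.Icc (1 / 2 : ℝ) 1) :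
    0 ≤ Real.log (2 * x) ∧ Real.log (2 * x) ≤ Real.log 2 :=
  ⟨Real.log_nonneg (by linarith [hx.1]),
    Real.log_le_log (by linarith [hx.1]) (by linarith [hx.2])⟩

lemma sum_le_sum_of_subset_of_nonpos {ι : Type*} {s t : Finset ι} {φ : ι → ℝ} (hst : s ⊆ t)
    (hφ : ∀ i ∈ t, i ∉ s → φ i ≤ 0) : ∑ i ∈ t, φ i ≤ ∑ i ∈ s, φ i := by
  have h := Finset.sum_le_sum_of_subset_of_nonneg (f := fun i => -φ i) hst
    fun i hi his => neg_nonneg.2 (hφ i hi his)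
  simpa [Finset.sum_neg_distrib] using h

/-- Each letter below `r` costs `a - φ l`, is paid at most once, and the remaining labels cost
nothing. -/
lemma sum_sub_le_of_injOn {E : Type*} {r : ℕ} {S : Finset E} {lab : E → ℕ}
    (hlab : ∀ f ∈ S, ∀ g ∈ S, lab f < r → lab f = lab g → f = g) {φ : ℕ → ℝ} {a : ℝ}
    (hφ : ∀ l, φ l ≤ a) (hφr : ∀ l, r ≤ l → φ l = a) :
    S.card * a + ∑ l ∈ Finset.range r, (φ l - a) ≤ ∑ f ∈ S, φ (lab f) := by
  have h1 : ∑ f ∈ S, (φ (lab f) - a) = ∑ f ∈ S.filter (fun f => lab f < r), (φ (lab f) - a) := by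
    rw [Finset.sum_filter_of_ne]
    intro f _ hne
    by_contra hc
    exact hne (by rw [hφr _ (not_lt.1 hc), sub_self])
  have h2 : ∑ f ∈ S.filter (fun f => lab f < r), (φ (lab f) - a)
      = ∑ l ∈ (S.filter (fun f => lab f < r)).image lab, (φ l - a) := by
    rw [Finset.sum_image]
    intro f hf g hg hfg
    simp only [Finset.coe_filter, Set.mem_ofPred_eq] at hf hg
    exact hlab f hf.1 g hg.1 hf.2 hfg
  have h3 : ∑ l ∈ Finset.range r, (φ l - a)
      ≤ ∑ l ∈ (S.filter (fun f => lab f < r)).image lab, (φ l - a) := by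
    refine sum_le_sum_of_subset_of_nonpos ?_ ?_
    · intro l hl
      simp only [Finset.mem_image, Finset.mem_filter] at hl
      obtain ⟨f, hf, rfl⟩ := hl
      exact Finset.mem_range.2 hf.2
    · exact fun l _ _ => by linarith [hφ l]
  rw [← h2, ← h1, Finset.sum_sub_distrib (s := S), Finset.sum_const, nsmul_eq_mul] at h3
  linarith

variable {E : Type*} [DecidableEq E]

lemma hasDerivAt_pow_mul (n : ℕ) {F : ℝ → ℝ} {F' x : ℝ} (hx : 0 < x) (hF : HasDerivAt F F' x) :
    HasDerivAt (fun x => x ^ n * F x) (x ^ n / x * (n * F x + x * F')) x := by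
  refine ((hasDerivAt_pow n x).mul hF).congr_deriv ?_
  have h : n * x ^ (n - 1) = x ^ n / x * n := by
    rcases n with _ | n
    · simp
    · rw [pow_succ]; field_simp; simp
  rw [h]
  field_simp

lemma hasDerivAt_poissonAdmissible_log (r : ℕ) (c : ℕ → ℕ) {x : ℝ} (hx : 0 < x) :
    HasDerivAt (fun x => poissonAdmissible r c (Real.log (2 * x)))
      ((∑ l ∈ Finset.range r, (poissonAdmissible r (c + Pi.single l 1) (Real.log (2 * x)) -
          poissonAdmissible r c (Real.log (2 * x)))) * (1 / x)) x :=
  (hasDerivAt_poissonAdmissible r c _).comp x (hasDerivAt_log_two_mul hx)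

lemma pow_card_erase {S : Finset E} {f : E} (hf : f ∈ S) {x : ℝ} (hx : 0 < x) :
    x ^ (S.erase f).card = x ^ S.card / x := by
  rw [← Finset.card_erase_add_one hf, pow_succ]
  field_simp

/-- Picking one carrier per letter already realises the whole loss; all other terms are at most `a`.
-/
lemma sum_le_of_surjOn {r : ℕ} {S : Finset E} {lab : E → ℕ}
    (hlab : ∀ l < r, ∃ f ∈ S, lab f = l) {φ : ℕ → ℝ} {a : ℝ} (hφ : ∀ l, φ l ≤ a) :
    ∑ f ∈ S, φ (lab f) ≤ S.card * a + ∑ l ∈ Finset.range r, (φ l - a) := by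
  have h1 : ∑ f ∈ S, (φ (lab f) - a) ≤ ∑ l ∈ Finset.range r, (φ l - a) := by
    have hex : ∀ l : Finset.range r, ∃ f ∈ S, lab f = l := fun l => hlab l (Finset.mem_range.1 l.2)
    choose φf hφf hφl using hex
    rw [← Finset.sum_attach (Finset.range r)]
    have hinj : Set.InjOn φf ((Finset.range r).attach : Set (Finset.range r)) := by
      intro l _ l' _ h
      apply Subtype.ext
      rw [← hφl l, ← hφl l', h]
    have h2 : ∑ l ∈ (Finset.range r).attach, (φ l - a)
        = ∑ f ∈ (Finset.range r).attach.image φf, (φ (lab f) - a) := by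
      rw [Finset.sum_image hinj]
      exact Finset.sum_congr rfl fun l _ => by rw [hφl]
    rw [h2]
    refine sum_le_sum_of_subset_of_nonpos ?_ ?_
    · intro f hf
      obtain ⟨l, _, rfl⟩ := Finset.mem_image.1 hf
      exact hφf l
    · exact fun f _ _ => by linarith [hφ (lab f)]
  rw [Finset.sum_sub_distrib (s := S), Finset.sum_const, nsmul_eq_mul] at h1
  linarith

end Bounds

section Bounds

variable {E : Type*}

/-- If at every time each letter is carried by at most one arrived element, then the letters
produced before the arrival of `e` are admissible with probability at least `1 - log 2`. -/
lemma one_sub_log_two_le_outcomeProb [Fintype E] (r : ℕ) {lab : Finset E → E → ℕ} (e : E)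
    (hlab : ∀ S, ∀ f ∈ S, ∀ g ∈ S, lab S f < r → lab S f = lab S g → f = g) :
    1 - Real.log 2 ≤ outcomeProb r lab e none Finset.univ 1 := by
  classical
  -- The subsolution: the probability that all of `S` arrives before `x`, times the Poisson
  -- probability once `e` is explored. Before that, the lower bound `1 - log (2 * y)` is integrated
  -- over the arrival time `y` of `e`.
  let W : Option (ℕ → ℕ) → Finset E → ℝ → ℝ := fun s S x =>
    match s with
    | some c => x ^ S.card * poissonAdmissible r c (Real.log (2 * x))
    | none => if e ∈ S then x ^ (S.erase e).card * (2 * x - 1 - x * Real.log (2 * x)) else 0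
  have key : W none Finset.univ 1 ≤ outcomeProb r lab e none Finset.univ 1 := by
    refine le_of_last_arrival_recursion (Q := outcomeProb r lab e) (step := nextState lab e)
      (fun s S x hx => outcomeProb_eq r lab e s S hx)
      (fun s S => integrableOn_outcomeProb r lab e s S) (fun s S => ?_) Finset.univ none
      (by norm_num)
    match s with
    | some c =>
      refine Or.inr ⟨?_, fun x => x ^ S.card / x * (S.card *
          poissonAdmissible r c (Real.log (2 * x)) + x *
          ((∑ l ∈ Finset.range r, (poissonAdmissible r (c + Pi.single l 1) (Real.log (2 * x)) -
            poissonAdmissible r c (Real.log (2 * x)))) * (1 / x))), fun x hx => ?_⟩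
      · simp only [W]
        rw [outcomeProb_some_half]
        norm_num [poissonAdmissible_zero_right]
      · have hx0 : 0 < x := by linarith [hx.1]
        refine ⟨hasDerivAt_pow_mul _ hx0 (hasDerivAt_poissonAdmissible_log r c hx0), ?_⟩
        have h1 : ∀ f ∈ S, W (nextState lab e (some c) S f) (S.erase f) x = x ^ S.card / x *
            poissonAdmissible r (c + Pi.single (lab S f) 1) (Real.log (2 * x)) := by
          intro f hf
          simp only [W, nextState]
          rw [pow_card_erase hf hx0]
        rw [Finset.sum_congr rfl h1, ← Finset.mul_sum]
        refine mul_le_mul_of_nonneg_left ?_ (div_nonneg (pow_pos hx0 _).le hx0.le)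
        have h2 := sum_sub_le_of_injOn (hlab S)
          (φ := fun l => poissonAdmissible r (c + Pi.single l 1) (Real.log (2 * x)))
          (fun l => poissonAdmissible_add_le r c _ (log_two_mul_mem hx).1)
          (fun l hl => poissonAdmissible_congr (c := c + Pi.single l 1) (d := c)
            (fun i hi => by simp [(hi.trans_le hl).ne]) _)
        refine le_trans (le_of_eq ?_) h2
        field_simp
    | none =>
      by_cases heS : e ∈ S
      · refine Or.inr ⟨?_, fun x => x ^ (S.erase e).card / x * ((S.erase e).card *
          (2 * x - 1 - x * Real.log (2 * x)) + x * (1 - Real.log (2 * x))), fun x hx => ?_⟩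
        · simp only [W, if_pos heS]
          rw [outcomeProb_none_half]
          norm_num
        · have hx0 : 0 < x := by linarith [hx.1]
          simp only [W, if_pos heS]
          refine ⟨hasDerivAt_pow_mul _ hx0 (hasDerivAt_expected_slack hx0), ?_⟩
          rw [← Finset.add_sum_erase _ _ heS]
          have h1 : ∀ f ∈ S.erase e, W (nextState lab e none S f) (S.erase f) x =
              x ^ (S.erase e).card / x * (2 * x - 1 - x * Real.log (2 * x)) := by
            intro f hf
            have hfe := Finset.ne_of_mem_erase hf
            simp only [W, nextState, if_neg hfe]
            rw [if_pos (Finset.mem_erase.2 ⟨Ne.symm hfe, heS⟩), Finset.erase_right_comm,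
              pow_card_erase hf hx0]
          have h2 : W (nextState lab e none S e) (S.erase e) x =
              x ^ (S.erase e).card * poissonAdmissible r 0 (Real.log (2 * x)) := by
            simp only [W, nextState, if_true]
          change _ ≤ W (nextState lab e none S e) (S.erase e) x +
            ∑ f ∈ S.erase e, W (nextState lab e none S f) (S.erase f) x
          rw [Finset.sum_congr rfl h1, h2, Finset.sum_const, nsmul_eq_mul]
          have h3 := one_sub_le_poissonAdmissible r (log_two_mul_mem hx).1
            ((log_two_mul_mem hx).2.trans_lt (by linarith [Real.log_two_lt_d9]))
          have h4 := mul_le_mul_of_nonneg_left h3 (pow_pos hx0 (S.erase e).card).le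
          have h5 : x ^ (S.erase e).card / x * ((S.erase e).card *
              (2 * x - 1 - x * Real.log (2 * x)) + x * (1 - Real.log (2 * x)))
              = (S.erase e).card * (x ^ (S.erase e).card / x *
                (2 * x - 1 - x * Real.log (2 * x)))
                + x ^ (S.erase e).card * (1 - Real.log (2 * x)) := by
            field_simp
          rw [h5]
          linarith
      · refine Or.inl fun x _ => ?_
        simp only [W, if_neg heS]
        exact outcomeProb_nonneg _ _ _ _ _ _
  refine le_trans (le_of_eq ?_) key
  simp only [W, Finset.mem_univ, if_true]
  norm_num

/-- The expected number of classes `{f | row f = j}`, `j < r`, that have no element of `S` in the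
sampling phase, given that the elements of `S` arrive before time `x`. -/
noncomputable def expectedMissing (r : ℕ) (row : E → ℕ) (S : Finset E) (x : ℝ) : ℝ :=
  ∑ j ∈ Finset.range r, (1 - 1 / (2 * x)) ^ (S.filter fun f => row f = j).card

lemma sum_pow_card_filter_erase [DecidableEq E] (row : E → ℕ) (S : Finset E) (j : ℕ) (u : ℝ) :
    ∑ f ∈ S, u ^ ((S.erase f).filter fun g => row g = j).card =
      (S.filter fun f => row f = j).card * u ^ ((S.filter fun f => row f = j).card - 1) +
        (S.card - (S.filter fun f => row f = j).card) * u ^ (S.filter fun f => row f = j).card := by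
  rw [← Finset.sum_filter_add_sum_filter_not S (fun f => row f = j)]
  congr 1
  · rw [Finset.sum_congr rfl (g := fun _ => u ^ ((S.filter fun f => row f = j).card - 1))]
    · simp
    · intro f hf
      rw [Finset.filter_erase, Finset.card_erase_of_mem hf]
  · rw [Finset.sum_congr rfl (g := fun _ => u ^ (S.filter fun f => row f = j).card)]
    · rw [Finset.sum_const, nsmul_eq_mul]
      congr 1
      rw [eq_sub_iff_add_eq', ← Nat.cast_add, Finset.card_filter_add_card_filter_not]
    · intro f hf
      rw [Finset.filter_erase, Finset.erase_eq_of_notMem]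
      simp only [Finset.mem_filter] at hf ⊢
      tauto

/-- Consequently `x ^ S.card * expectedMissing r row S x` solves the last-arrival recursion with
equality, and can be added to the Poisson bound as an error term. -/
lemma hasDerivAt_expectedMissing [DecidableEq E] (r : ℕ) (row : E → ℕ) (S : Finset E) {x : ℝ}
    (hx : 0 < x) :
    HasDerivAt (expectedMissing r row S)
      ((∑ f ∈ S, expectedMissing r row (S.erase f) x - S.card * expectedMissing r row S x) / x)
      x := by
  have h1 : HasDerivAt (fun x : ℝ => 1 - 1 / (2 * x)) (1 / (2 * x ^ 2)) x := by
    refine ((hasDerivAt_const x (1 : ℝ)).sub ((hasDerivAt_const x (1 : ℝ)).div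
      ((hasDerivAt_id x).const_mul 2) (by simp; exact hx.ne'))).congr_deriv ?_
    simp only [id]
    field_simp
    ring
  have h2 : HasDerivAt (expectedMissing r row S) (∑ j ∈ Finset.range r,
      ((S.filter fun f => row f = j).card * (1 - 1 / (2 * x)) ^
        ((S.filter fun f => row f = j).card - 1) * (1 / (2 * x ^ 2)))) x :=
    HasDerivAt.fun_sum fun j _ => h1.pow _
  refine h2.congr_deriv ?_
  simp only [expectedMissing]
  rw [Finset.sum_comm, Finset.mul_sum, ← Finset.sum_sub_distrib, Finset.sum_div]
  refine Finset.sum_congr rfl fun j _ => ?_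
  rw [sum_pow_card_filter_erase]
  generalize hk : (S.filter fun f => row f = j).card = k
  rcases k with _ | k
  · simp
  · simp only [Nat.add_sub_cancel, pow_succ]
    generalize hu : (1 - 1 / (2 * x)) ^ k = v
    field_simp
    push_cast
    ring

lemma expectedMissing_nonneg (r : ℕ) (row : E → ℕ) (S : Finset E) {x : ℝ} (hx : 1 / 2 ≤ x) :
    0 ≤ expectedMissing r row S x := by
  refine Finset.sum_nonneg fun j _ => pow_nonneg ?_ _
  rw [sub_nonneg, div_le_one (by linarith)]
  linarith

lemma one_le_expectedMissing {r : ℕ} {row : E → ℕ} {S : Finset E} {x : ℝ} (hx : 1 / 2 ≤ x) {j : ℕ}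
    (hj : j < r) (hS : ∀ f ∈ S, row f ≠ j) : 1 ≤ expectedMissing r row S x := by
  have h0 : 0 ≤ 1 - 1 / (2 * x) := by
    rw [sub_nonneg, div_le_one (by linarith)]
    linarith
  refine le_trans (le_of_eq ?_) (Finset.single_le_sum
    (f := fun j => (1 - 1 / (2 * x)) ^ (S.filter fun f => row f = j).card)
    (fun j _ => pow_nonneg h0 _) (Finset.mem_range.2 hj))
  rw [Finset.filter_eq_empty_iff.2 fun f hf => hS f hf]
  simp

/-- If at every time every class that has an arrived element carries a letter, then the letters
produced before the arrival of `e` are admissible with probability not much larger than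
`1 - log 2`. -/
lemma outcomeProb_le_one_sub_log_two [Fintype E] (r : ℕ) {lab : Finset E → E → ℕ} (e : E) (row : E → ℕ)
    (hlab : ∀ S : Finset E, ∀ l < r, (∃ f ∈ S, row f = l) → ∃ f ∈ S, lab S f = l)
    [DecidableEq E] :
    outcomeProb r lab e none Finset.univ 1 ≤ 1 - Real.log 2 +
      (Real.log 2 * Real.exp 1 / 2) ^ r / 2 +
        expectedMissing r row (Finset.univ.erase e) 1 / 2 := by
  set δ : ℝ := (Real.log 2 * Real.exp 1 / 2) ^ r with hδ
  have hδ0 : 0 ≤ δ := by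
    have := Real.log_nonneg (one_le_two (α := ℝ))
    positivity
  -- The supersolution adds two errors: the Poisson excess `δ` and the expected number of missing
  -- classes. Before `e` is explored both carry the factor `x - 1 / 2`, the length of the window for
  -- its arrival.
  let W : Option (ℕ → ℕ) → Finset E → ℝ → ℝ := fun s S x =>
    match s with
    | some c => x ^ S.card *
        (poissonAdmissible r c (Real.log (2 * x)) + expectedMissing r row S x)
    | none => if e ∈ S then x ^ (S.erase e).card * ((2 * x - 1 - x * Real.log (2 * x)) +
        (x - 1 / 2) * (δ + expectedMissing r row (S.erase e) x)) else 0
  have key : outcomeProb r lab e none Finset.univ 1 ≤ W none Finset.univ 1 := by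
    refine last_arrival_recursion_le (Q := outcomeProb r lab e) (step := nextState lab e)
      (fun s S x hx => outcomeProb_eq r lab e s S hx)
      (fun s S => integrableOn_outcomeProb r lab e s S) (fun s S => ?_) Finset.univ none
      (by norm_num)
    match s with
    | some c =>
      by_cases hall : ∀ l < r, ∃ f ∈ S, row f = l
      · refine Or.inr ⟨?_, fun x => x ^ S.card / x * (S.card * (poissonAdmissible r c (Real.log (2 * x)) +
            expectedMissing r row S x) + x *
            ((∑ l ∈ Finset.range r, (poissonAdmissible r (c + Pi.single l 1) (Real.log (2 * x)) -
              poissonAdmissible r c (Real.log (2 * x)))) * (1 / x) +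
            (∑ f ∈ S, expectedMissing r row (S.erase f) x - S.card * expectedMissing r row S x)
              / x)), fun x hx => ?_⟩
        · simp only [W]
          rw [outcomeProb_some_half]
          have := expectedMissing_nonneg r row S (le_refl (1 / 2 : ℝ))
          have h1 : poissonAdmissible r c (Real.log (2 * (1 / 2))) = wordCount r 0 c := by
            norm_num [poissonAdmissible_zero_right]
          rw [h1]
          gcongr
          linarith
        · have hx0 : 0 < x := by linarith [hx.1]
          refine ⟨hasDerivAt_pow_mul _ hx0 ((hasDerivAt_poissonAdmissible_log r c hx0).add
            (hasDerivAt_expectedMissing r row S hx0)), ?_⟩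
          simp only [W, nextState]
          rw [Finset.sum_congr (s₁ := S) rfl fun f hf => by rw [pow_card_erase hf hx0], ← Finset.mul_sum,
            Finset.sum_add_distrib]
          refine mul_le_mul_of_nonneg_left ?_ (by positivity)
          refine le_trans (add_le_add_left (sum_le_of_surjOn (S := S) (lab := lab S)
            (fun l hl => hlab S l hl (hall l hl))
            (φ := fun l => poissonAdmissible r (c + Pi.single l 1) (Real.log (2 * x)))
            (fun l => poissonAdmissible_add_le r c _ (log_two_mul_mem hx).1)) _) (le_of_eq ?_)
          field_simp
          ring
      -- If a class is missing from `S`, the error term is at least 1 and the bound is trivial.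
      · push Not at hall
        obtain ⟨l, hl, hlS⟩ := hall
        refine Or.inl fun x hx => (outcomeProb_le r lab e _ S hx).trans ?_
        simp only [W]
        have h1 := one_le_expectedMissing hx.1 hl hlS
        have h2 := poissonAdmissible_nonneg r c (log_two_mul_mem hx).1
        exact le_mul_of_one_le_right (pow_nonneg (by linarith [hx.1]) _) (by linarith)
    | none =>
      by_cases heS : e ∈ S
      · refine Or.inr ⟨?_, fun x => x ^ (S.erase e).card / x * ((S.erase e).card *
          ((2 * x - 1 - x * Real.log (2 * x)) +
            (x - 1 / 2) * (δ + expectedMissing r row (S.erase e) x)) + x *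
          ((1 - Real.log (2 * x)) + (1 * (δ + expectedMissing r row (S.erase e) x) +
            (x - 1 / 2) * ((∑ f ∈ S.erase e, expectedMissing r row ((S.erase e).erase f) x -
              (S.erase e).card * expectedMissing r row (S.erase e) x) / x)))), fun x hx => ?_⟩
        · simp only [W, if_pos heS]
          rw [outcomeProb_none_half]
          norm_num
        · have hx0 : 0 < x := by linarith [hx.1]
          simp only [W, if_pos heS]
          refine ⟨hasDerivAt_pow_mul _ hx0 ((hasDerivAt_expected_slack hx0).add
            (((hasDerivAt_id x).sub_const _).mul
              ((hasDerivAt_expectedMissing r row (S.erase e) hx0).const_add δ))), ?_⟩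
          rw [← Finset.add_sum_erase _ _ heS]
          have h1 : ∀ f ∈ S.erase e, W (nextState lab e none S f) (S.erase f) x =
              x ^ (S.erase e).card / x * ((2 * x - 1 - x * Real.log (2 * x)) +
              (x - 1 / 2) * (δ + expectedMissing r row ((S.erase e).erase f) x)) := by
            intro f hf
            have hfe := Finset.ne_of_mem_erase hf
            simp only [W, nextState, if_neg hfe]
            rw [if_pos (Finset.mem_erase.2 ⟨Ne.symm hfe, heS⟩), Finset.erase_right_comm,
              pow_card_erase hf hx0]
          have h2 : W (nextState lab e none S e) (S.erase e) x = x ^ (S.erase e).card *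
              (poissonAdmissible r 0 (Real.log (2 * x)) +
                expectedMissing r row (S.erase e) x) := by
            simp only [W, nextState, if_true]
          change W (nextState lab e none S e) (S.erase e) x +
            ∑ f ∈ S.erase e, W (nextState lab e none S f) (S.erase f) x ≤ _
          rw [Finset.sum_congr rfl h1, h2, ← Finset.mul_sum, Finset.sum_add_distrib,
            ← Finset.mul_sum, Finset.sum_add_distrib, Finset.sum_const, Finset.sum_const,
            nsmul_eq_mul, nsmul_eq_mul]
          have h3 := poissonAdmissible_le r (log_two_mul_mem hx).1 (log_two_mul_mem hx).2
          refine le_trans (add_le_add_left (mul_le_mul_of_nonneg_left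
            (add_le_add_left h3 _) (pow_pos hx0 (S.erase e).card).le) _) (le_of_eq ?_)
          rw [← hδ]
          field_simp
          ring
      · refine Or.inl fun x _ => ?_
        simp only [W, if_neg heS]
        rw [outcomeProb_none_of_notMem r lab heS]
  refine key.trans (le_of_eq ?_)
  simp only [W, Finset.mem_univ, if_true]
  norm_num
  ring

end Bounds

/-! ### Letters in laminar matroids -/

lemma sum_letterCount {E : Type*} (lab : Finset E → E → ℕ) (le : E → E → Prop) (late : E → Prop)
    (S : Finset E) (n : ℕ) :
    ∑ l ∈ Finset.range n, letterCount lab le late S l =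
      {f | f ∈ S ∧ late f ∧ lab (open Classical in S.filter fun g => le g f) f < n}.ncard := by
  classical
  have h : {f | f ∈ S ∧ late f ∧ lab (S.filter fun g => le g f) f < n} =
      (S.filter fun f => late f ∧ lab (S.filter fun g => le g f) f < n : Finset E) := by
    ext f
    simp
  rw [h, Set.ncard_coe_finset, Finset.card_eq_sum_card_fiberwise
    (f := fun f => lab (S.filter fun g => le g f) f) (t := Finset.range n)]
  · refine Finset.sum_congr rfl fun l hl => ?_
    rw [letterCount, Finset.filter_filter]
    congr 1
    refine Finset.filter_congr fun f _ => ?_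
    have := Finset.mem_range.1 hl
    constructor
    · rintro ⟨h1, rfl⟩
      exact ⟨⟨h1, this⟩, rfl⟩
    · exact fun h1 => ⟨h1.1.1, h1.2⟩
  · intro f hf
    simp only [Finset.coe_filter, Set.mem_ofPred_eq] at hf
    simp [hf.2.2]

/-- Hall's theorem: `f` may receive any letter below the first `n` with `f ∈ U n`. A family of such
elements lies in the largest of these sets, so its size is at most the number of letters available
to it. -/
lemma exists_injective_labelling {E : Type*} [Finite E] {U : ℕ → Set E} (hU : Monotone U)
    {B : Set E} (r : ℕ) (hB : ∀ n, (B ∩ U n).ncard ≤ n) :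
    ∃ lab : E → ℕ, (∀ f g, lab f < r → lab f = lab g → f = g) ∧
      ∀ f ∈ B, ∀ n ≤ r, f ∈ U n → lab f < n := by
  classical
  have hw : ∀ f : {f // f ∈ B ∩ U r}, (f : E) ∈ U (sInf {n | (f : E) ∈ U n}) := fun f =>
    Nat.sInf_mem (s := {n | (f : E) ∈ U n}) ⟨r, f.2.2⟩
  obtain ⟨φ, hinj, hφ⟩ := (Finset.all_card_le_biUnion_card_iff_exists_injective
    (fun f : {f // f ∈ B ∩ U r} => Finset.range (sInf {n | (f : E) ∈ U n}))).1 (by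
      intro s
      rcases s.eq_empty_or_nonempty with rfl | hs
      · simp
      obtain ⟨f, hf, hmax⟩ := s.exists_max_image (fun f => sInf {n | (f : E) ∈ U n}) hs
      calc s.card = ((s.image Subtype.val : Finset E) : Set E).ncard := by
            rw [Set.ncard_coe_finset, Finset.card_image_of_injective _ Subtype.val_injective]
        _ ≤ (B ∩ U (sInf {n | (f : E) ∈ U n})).ncard := by
            refine Set.ncard_le_ncard ?_ (Set.toFinite _)
            intro g hg
            obtain ⟨g, hgs, rfl⟩ := Finset.mem_image.1 (Finset.mem_coe.1 hg)
            exact ⟨g.2.1, hU (hmax g hgs) (hw g)⟩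
        _ ≤ sInf {n | (f : E) ∈ U n} := hB _
        _ = (Finset.range (sInf {n | (f : E) ∈ U n})).card := (Finset.card_range _).symm
        _ ≤ _ := Finset.card_le_card (Finset.subset_biUnion_of_mem
              (fun f : {f // f ∈ B ∩ U r} => Finset.range (sInf {n | (f : E) ∈ U n})) hf))
  -- The value `r` lies outside the alphabet and marks elements without a letter.
  refine ⟨fun f => if h : f ∈ B ∩ U r then φ ⟨f, h⟩ else r, ?_, ?_⟩
  · intro f g hfr hfg
    beta_reduce at hfr hfg
    have hf : f ∈ B ∩ U r := by
      by_contra hc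
      rw [dif_neg hc] at hfr
      exact lt_irrefl _ hfr
    have hg : g ∈ B ∩ U r := by
      by_contra hc
      rw [hfg] at hfr
      rw [dif_neg hc] at hfr
      exact lt_irrefl _ hfr
    simp only [dif_pos hf, dif_pos hg] at hfg
    exact congrArg Subtype.val (hinj hfg)
  · intro f hf n hn hfn
    have h : f ∈ B ∩ U r := ⟨hf, hU hn hfn⟩
    simp only [dif_pos h]
    exact (Finset.mem_range.1 (hφ ⟨f, h⟩)).trans_le (Nat.sInf_le hfn)

section Laminar

variable {E : Type*} {q : ℕ} {C : Fin q → Set E} {g : Fin q → ℕ}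

/-- The union of the constraint sets that contain `e` and have capacity at most `n`. -/
def constraintUnion (C : Fin q → Set E) (g : Fin q → ℕ) (e : E) (n : ℕ) : Set E :=
  {f | ∃ i, e ∈ C i ∧ f ∈ C i ∧ g i ≤ n}

lemma constraintUnion_mono (C : Fin q → Set E) (g : Fin q → ℕ) (e : E) :
    Monotone (constraintUnion C g e) :=
  fun _ _ hmn _ ⟨i, he, hf, hg⟩ => ⟨i, he, hf, hg.trans hmn⟩

variable [Finite E]

/-- The constraint sets through `e` form a chain, so the union of those of capacity at most `n`, if
nonempty, is its largest member. -/
lemma ncard_inter_constraintUnion_le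
    (hC : ∀ i j, C i ⊆ C j ∨ C j ⊆ C i ∨ Disjoint (C i) (C j)) {I : Set E}
    (hI : ∀ i, (I ∩ C i).encard ≤ (g i : ℕ∞)) (e : E) (n : ℕ) :
    (I ∩ constraintUnion C g e n).ncard ≤ n := by
  classical
  rcases (Finset.univ.filter fun i => e ∈ C i ∧ g i ≤ n).eq_empty_or_nonempty with h | h
  · have : I ∩ constraintUnion C g e n = ∅ := by
      rw [Set.eq_empty_iff_forall_notMem]
      rintro f ⟨_, i, he, _, hg⟩
      have : i ∈ (Finset.univ.filter fun i => e ∈ C i ∧ g i ≤ n) := by simp [he, hg]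
      rw [h] at this
      simp at this
    simp [this]
  · obtain ⟨i, hi, hmax⟩ := Finset.exists_max_image _ (fun i => (C i).ncard) h
    simp only [Finset.mem_filter, Finset.mem_univ, true_and] at hi hmax
    have hsub : I ∩ constraintUnion C g e n ⊆ I ∩ C i := by
      rintro f ⟨hfI, j, hej, hfj, hgj⟩
      refine ⟨hfI, ?_⟩
      rcases hC i j with h1 | h1 | h1
      · rw [Set.eq_of_subset_of_ncard_le h1 (hmax j ⟨hej, hgj⟩) (Set.toFinite _)]
        exact hfj
      · exact h1 hfj
      · exact absurd hej (Set.disjoint_left.1 h1 hi.1)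
    have h2 : (I ∩ C i).ncard ≤ g i := by
      have := hI i
      rwa [← (Set.toFinite _).cast_ncard_eq, Nat.cast_le] at this
    exact ((Set.ncard_le_ncard hsub (Set.toFinite _)).trans h2).trans hi.2

lemma notMem_closure_of_ncard_lt {M : Matroid E} (hE : M.E = Set.univ)
    (hM : ∀ I : Set E, M.Indep I ↔ I ⊆ M.E ∧ ∀ i, (I ∩ C i).encard ≤ (g i : ℕ∞)) {e : E}
    {J : Set E} (heJ : e ∉ J) (hJ : ∀ i, e ∈ C i → (J ∩ C i).ncard < g i) :
    e ∉ M.closure J := by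
  obtain ⟨I, hI⟩ := M.exists_isBasis J (by simp [hE])
  rw [← hI.closure_eq_closure,
    hI.indep.notMem_closure_iff_of_notMem (fun h => heJ (hI.subset h)) (by simp [hE]), hM]
  refine ⟨by simp [hE], fun i => ?_⟩
  by_cases he : e ∈ C i
  · rw [← (Set.toFinite _).cast_ncard_eq, Nat.cast_le, Set.insert_inter_of_mem he]
    have h1 : (I ∩ C i).ncard ≤ (J ∩ C i).ncard :=
      Set.ncard_le_ncard (Set.inter_subset_inter_left _ hI.subset) (Set.toFinite _)
    have h2 := Set.ncard_insert_le e (I ∩ C i)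
    have h3 := hJ i he
    omega
  · rw [Set.insert_inter_of_notMem he]
    exact ((hM I).1 hI.indep).2 i

end Laminar

/-- The greedy-improving algorithm with sample fraction `1/2` is `(1 - log 2)`-probability-competitive
on laminar matroids. -/
theorem IsLaminar.isProbCompetitive {E : Type*} [Fintype E] {M : Matroid E} (hE : M.E = Set.univ)
    (hM : IsLaminar M) {succ : E → E → Prop} (h : IsStrictTotalOrder E succ) :
    IsProbCompetitive (1 / 2) M succ (1 - Real.log 2) := by
  classical
  obtain ⟨q, C, g, -, hC, hM⟩ := hM
  intro e he
  rw [hE] at he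
  have hlab : ∀ S : Finset E, ∃ lab : E → ℕ, (∀ f g', lab f < ∑ i, g i → lab f = lab g' → f = g') ∧
      ∀ f ∈ opt M succ (S : Set E), ∀ n ≤ ∑ i, g i, f ∈ constraintUnion C g e n → lab f < n :=
    fun S => exists_injective_labelling (constraintUnion_mono C g e) _ fun n =>
      ncard_inter_constraintUnion_le hC ((hM _).1 (opt_indep hE h _)).2 e n
  choose lab hinj hlab using hlab
  -- The alphabet size `∑ i, g i` only has to dominate every capacity.
  refine (one_sub_log_two_le_outcomeProb (∑ i, g i) (lab := lab) e
    (fun S f _ g' _ => hinj S f g')).trans ?_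
  refine ENNReal.toReal_mono (measure_ne_top _ _) (measure_mono_ae ?_)
  filter_upwards [ae_injective] with t ht
  rintro ⟨-, -, hlate, hadm⟩
  refine (mem_greedyImproving_iff hE ht).2 ⟨hlate, mem_opt_of_subset hE h (Set.subset_univ _) he
    (le_refl (t e)), ?_⟩
  refine notMem_closure_of_ncard_lt hE hM (fun hc => lt_irrefl (t e) hc.2.1) fun i hi => ?_
  have hgi : 1 ≤ g i := by
    have h1 := ((hM _).1 (opt_indep hE h Set.univ)).2 i
    rw [← (Set.toFinite _).cast_ncard_eq, Nat.cast_le] at h1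
    have h3 : (opt M succ Set.univ ∩ C i).Nonempty := ⟨e, he, hi⟩
    exact le_trans ((Set.ncard_pos (Set.toFinite _)).2 h3) h1
  have hgr : g i ≤ ∑ i, g i := Finset.single_le_sum (fun _ _ => Nat.zero_le _) (Finset.mem_univ i)
  -- Letters start at 0: a constraint of capacity `g i` concerns the letters up to `g i - 1`, and
  -- admissibility leaves one place free for `e`.
  have h2 := (hadm : Admissible _ _) (g i - 1) (by omega)
  rw [Nat.sub_add_cancel hgi, sum_letterCount] at h2
  refine lt_of_le_of_lt (Set.ncard_le_ncard ?_ (Set.toFinite _)) (lt_of_le_of_lt h2 (by omega))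
  rintro f ⟨⟨hfl, hfe, hfi⟩, hfC⟩
  refine ⟨by simpa using hfe, hfl, ?_⟩
  have hset : ((((Finset.univ.filter fun f => ¬ t e ≤ t f)).filter fun g => t g ≤ t f :
      Finset E) : Set E) = {g | t g ≤ t f} := by
    ext k
    simp only [Finset.coe_filter, Finset.mem_filter, Finset.mem_univ, true_and, not_le,
      Set.mem_ofPred_eq, and_iff_right_iff_imp]
    exact fun hk => lt_of_le_of_lt hk hfe
  have h3 := hlab (((Finset.univ.filter fun f => ¬ t e ≤ t f)).filter fun g => t g ≤ t f) f
    (by rw [hset]; exact hfi) (g i) hgr ⟨i, hi, hfC, le_rfl⟩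
  convert h3

/-! ### The nested matroid and tightness -/

section Chain

/-- The independence condition of the nested laminar matroid on `r` rows of `q` elements, in which
the union of the first `i` rows has capacity `i`. -/
def ChainIndep (r q : ℕ) (I : Set (Fin r × Fin q)) : Prop :=
  ∀ i : Fin r, (I ∩ {x | x.1 ≤ i}).ncard ≤ i.val + 1

lemma ChainIndep.subset {r q : ℕ} {I J : Set (Fin r × Fin q)} (hJ : ChainIndep r q J)
    (hIJ : I ⊆ J) : ChainIndep r q I := fun i =>
  (Set.ncard_le_ncard (Set.inter_subset_inter_left _ hIJ) (Set.toFinite _)).trans (hJ i)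

lemma ChainIndep.insert {r q : ℕ} {I : Set (Fin r × Fin q)} (hI : ChainIndep r q I)
    {x : Fin r × Fin q} (hx : ∀ i, x.1 ≤ i → (I ∩ {x | x.1 ≤ i}).ncard ≤ i.val) :
    ChainIndep r q (insert x I) := by
  intro i
  by_cases hxi : x.1 ≤ i
  · rw [Set.insert_inter_of_mem (show x ∈ {x : Fin r × Fin q | x.1 ≤ i} from hxi)]
    exact (Set.ncard_insert_le _ _).trans (Nat.succ_le_succ (hx i hxi))
  · rw [Set.insert_inter_of_notMem (show x ∉ {x : Fin r × Fin q | x.1 ≤ i} from hxi)]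
    exact hI i

lemma ChainIndep.augment {r q : ℕ} {I J : Set (Fin r × Fin q)} (hI : ChainIndep r q I)
    (hJ : ChainIndep r q J) (hIJ : I.ncard < J.ncard) :
    ∃ x ∈ J, x ∉ I ∧ ChainIndep r q (Insert.insert x I) := by
  classical
  rcases (Finset.univ.filter fun i : Fin r =>
    i.val + 1 ≤ (I ∩ {x | x.1 ≤ i}).ncard).eq_empty_or_nonempty with h | h
  · obtain ⟨x, hxJ, hxI⟩ := Set.exists_mem_notMem_of_ncard_lt_ncard hIJ (Set.toFinite _)
    refine ⟨x, hxJ, hxI, hI.insert fun i _ => ?_⟩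
    by_contra hc
    have : i ∈ (Finset.univ.filter fun i : Fin r => i.val + 1 ≤ (I ∩ {x | x.1 ≤ i}).ncard) := by
      simp only [Finset.mem_filter, Finset.mem_univ, true_and]
      omega
    rw [h] at this
    simp at this
  -- Take the last tight constraint `i` of `I`. Beyond it `J` has more elements than `I`, and an
  -- element there meets only constraints that are not tight.
  · obtain ⟨i, hi, hmax⟩ := Finset.exists_max_image _ id h
    simp only [Finset.mem_filter, Finset.mem_univ, true_and, id] at hi hmax
    have hsplit : ∀ K : Set (Fin r × Fin q),
        (K ∩ {x | x.1 ≤ i}).ncard + (K \ {x | x.1 ≤ i}).ncard = K.ncard := fun K =>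
      Set.ncard_inter_add_ncard_sdiff_eq_ncard K _ (Set.toFinite _)
    have h1 := hsplit I
    have h2 := hsplit J
    have h3 := hJ i
    obtain ⟨x, hxJ, hxI⟩ := Set.exists_mem_notMem_of_ncard_lt_ncard
      (show (I \ {x | x.1 ≤ i}).ncard < (J \ {x | x.1 ≤ i}).ncard by omega) (Set.toFinite _)
    refine ⟨x, hxJ.1, fun hc => hxI ⟨hc, hxJ.2⟩, hI.insert fun j hj => ?_⟩
    by_contra hc
    exact hxJ.2 (hj.trans (hmax j (by omega)))

/-- The nested laminar matroid on `r` rows of `q` elements, in which the union of the first `i` rows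
has capacity `i`. -/
def chainMatroid (r q : ℕ) : Matroid (Fin r × Fin q) :=
  (IndepMatroid.ofFinite (E := Set.univ) Set.finite_univ (ChainIndep r q) (fun i => by simp)
    (fun _ _ => ChainIndep.subset) (fun _ _ => ChainIndep.augment)
    (fun _ _ => Set.subset_univ _)).matroid

lemma chainMatroid_ground (r q : ℕ) : (chainMatroid r q).E = Set.univ := rfl

lemma chainMatroid_indep {r q : ℕ} {I : Set (Fin r × Fin q)} :
    (chainMatroid r q).Indep I ↔ ChainIndep r q I := Iff.rfl

lemma chainMatroid_indep_iff {r q : ℕ} (I : Set (Fin r × Fin q)) :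
    (chainMatroid r q).Indep I ↔
      ∀ i : Fin r, (I ∩ {x | x.1 ≤ i}).encard ≤ (i.val + 1 : ℕ) := by
  rw [chainMatroid_indep]
  refine forall_congr' fun i => ?_
  rw [← (Set.toFinite (I ∩ {x | x.1 ≤ i})).cast_ncard_eq, Nat.cast_le]

lemma isLaminar_chainMatroid (r q : ℕ) : IsLaminar (chainMatroid r q) := by
  refine ⟨r, fun i => {x | x.1 ≤ i}, fun i => i.val + 1, fun i => Set.subset_univ _,
    fun i j => ?_, fun I => ?_⟩
  · rcases le_total i j with h | h
    · exact Or.inl fun x (hx : x.1 ≤ i) => show x.1 ≤ j from hx.trans h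
    · exact Or.inr (Or.inl fun x (hx : x.1 ≤ j) => show x.1 ≤ i from hx.trans h)
  · rw [chainMatroid_indep_iff, chainMatroid_ground]
    simp only [Set.subset_univ, true_and]

lemma loopless_chainMatroid (r q : ℕ) : (chainMatroid r q).Loopless := by
  rw [Matroid.loopless_iff_forall_isNonloop]
  intro x _
  rw [← Matroid.indep_singleton, chainMatroid_indep]
  intro i
  refine (Set.ncard_le_ncard Set.inter_subset_left (Set.toFinite _)).trans ?_
  simp

variable {r q : ℕ} {succ : Fin r × Fin q → Fin r × Fin q → Prop}

/-- The more valuable elements of `S` lie in strictly earlier rows, so a basis of them has at most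
`b.1` elements and leaves room for `b`. -/
lemma mem_opt_chainMatroid (h : IsStrictTotalOrder (Fin r × Fin q) succ)
    (hrow : ∀ x y : Fin r × Fin q, x.1 < y.1 → succ x y) {S : Set (Fin r × Fin q)}
    {b : Fin r × Fin q} (hb : b ∈ S) (hbest : ∀ x ∈ S, x.1 = b.1 → ¬ succ x b) :
    b ∈ opt (chainMatroid r q) succ S := by
  rw [mem_opt_iff (chainMatroid_ground r q) h]
  refine ⟨hb, ?_⟩
  obtain ⟨I, hI⟩ := (chainMatroid r q).exists_isBasis {f | f ∈ S ∧ succ f b} (Set.subset_univ _)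
  have hIrow : ∀ x ∈ I, x.1 < b.1 := by
    intro x hx
    obtain ⟨hxS, hxb⟩ := hI.subset hx
    rcases lt_trichotomy x.1 b.1 with h1 | h1 | h1
    · exact h1
    · exact absurd hxb (hbest x hxS h1)
    · exact absurd (h.trans _ _ _ hxb (hrow _ _ h1)) (h.irrefl x)
  have hIind : ChainIndep r q I := hI.indep
  rw [← hI.closure_eq_closure, hI.indep.notMem_closure_iff_of_notMem
    (fun hc => lt_irrefl _ (hIrow b hc)) (Set.mem_univ _)]
  refine hIind.insert fun i hi => ?_
  have hi' : b.1.val ≤ i.val := hi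
  by_cases hb0 : b.1.val = 0
  · have : I ∩ {x | x.1 ≤ i} = ∅ := by
      rw [Set.eq_empty_iff_forall_notMem]
      rintro x ⟨hx, -⟩
      have : x.1.val < b.1.val := hIrow x hx
      omega
    simp [this]
  · have hlt : b.1.val - 1 < r := by omega
    have h1 := hIind ⟨b.1.val - 1, hlt⟩
    have h2 : I ∩ {x | x.1 ≤ i} ⊆ I ∩ {x | x.1 ≤ (⟨b.1.val - 1, hlt⟩ : Fin r)} := by
      rintro x ⟨hx, -⟩
      refine ⟨hx, ?_⟩
      have h3 : x.1.val < b.1.val := hIrow x hx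
      exact show x.1.val ≤ b.1.val - 1 by omega
    have h3 := Set.ncard_le_ncard h2 (Set.toFinite _)
    simp only at h1
    omega

/-- An element of the first row lies in every constraint set. If it is not spanned, a basis of `J`
leaves a free place in each constraint, so any further element of `J` could be added; hence `J` is
its own basis. -/
lemma ncard_le_of_notMem_closure {e : Fin r × Fin q} (he : e.1.val = 0) {J : Set (Fin r × Fin q)}
    (hJ : e ∉ (chainMatroid r q).closure J) (i : Fin r) : (J ∩ {x | x.1 ≤ i}).ncard ≤ i.val := by
  obtain ⟨I, hI⟩ := (chainMatroid r q).exists_isBasis J (Set.subset_univ _)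
  have heI : e ∉ I := fun hc => hJ ((chainMatroid r q).mem_closure_of_mem (hI.subset hc)
    (Set.subset_univ _))
  have hle : ∀ i, e ∈ {x : Fin r × Fin q | x.1 ≤ i} := fun i =>
    show e.1.val ≤ i.val by omega
  rw [← hI.closure_eq_closure, hI.indep.notMem_closure_iff_of_notMem heI (Set.mem_univ _)] at hJ
  have hcard : ∀ i : Fin r, (I ∩ {x | x.1 ≤ i}).ncard ≤ i.val := by
    intro i
    have h1 := (hJ : ChainIndep r q (insert e I)) i
    rw [Set.insert_inter_of_mem (hle i), Set.ncard_insert_of_notMem (fun hc => heI hc.1)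
      (Set.toFinite _)] at h1
    omega
  have hJI : J ⊆ I := by
    intro x hx
    by_contra hxI
    have hx2 : (chainMatroid r q).Indep (insert x I) :=
      ChainIndep.insert (hI.indep : ChainIndep r q I) fun i _ => hcard i
    rw [← hI.indep.notMem_closure_iff_of_notMem hxI (Set.mem_univ _)] at hx2
    exact hx2 (hI.subset_closure hx)
  exact (Set.ncard_le_ncard (Set.inter_subset_inter_left _ hJI) (Set.toFinite _)).trans (hcard i)

lemma ae_lt_one {E : Type*} [Fintype E] :
    ∀ᵐ t ∂(arrivalLaw E), ∀ f ∈ (Finset.univ : Finset E), (t f : ℝ) < 1 := by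
  have h := arrivalLaw_real_forall_lt (Finset.univ : Finset E) (y := 1) zero_le_one le_rfl
  rw [one_pow, measureReal_def, ENNReal.toReal_eq_one_iff] at h
  exact (mem_ae_iff_prob_eq_one (measurableSet_forall_lt _ _)).2 h

open Classical in
/-- The letter of an element of the optimum of the arrived elements is the index of its row. -/
noncomputable def rowLabel (r q : ℕ) (succ : Fin r × Fin q → Fin r × Fin q → Prop)
    (S : Finset (Fin r × Fin q)) (f : Fin r × Fin q) : ℕ :=
  if f ∈ opt (chainMatroid r q) succ (S : Set (Fin r × Fin q)) then f.1.val else r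

lemma exists_best (h : IsStrictTotalOrder (Fin r × Fin q) succ) (S : Finset (Fin r × Fin q))
    {l : ℕ} (hl : ∃ f ∈ S, f.1.val = l) :
    ∃ b ∈ S, b.1.val = l ∧ ∀ x ∈ S, x.1 = b.1 → ¬ succ x b := by
  obtain ⟨f, hf, hfl⟩ := hl
  obtain ⟨b, ⟨hbS, hbl⟩, hb⟩ := (wellFounded_of_isStrictTotalOrder h).has_min
    {x | x ∈ S ∧ x.1.val = l} ⟨f, hf, hfl⟩
  exact ⟨b, hbS, hbl, fun x hx hxb => hb x ⟨hx, by rw [hxb, hbl]⟩⟩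

lemma greedyImproving_le_outcomeProb {e : Fin r × Fin q} (he : e.1.val = 0) :
    (arrivalLaw (Fin r × Fin q)).real {t | e ∈ greedyImproving (1 / 2) (chainMatroid r q) succ t} ≤
      outcomeProb r (rowLabel r q succ) e none Finset.univ 1 := by
  classical
  refine ENNReal.toReal_mono (measure_ne_top _ _) (measure_mono_ae ?_)
  filter_upwards [ae_injective, ae_lt_one] with t ht ht1
  intro hsel
  obtain ⟨hlate, -, hcl⟩ := (mem_greedyImproving_iff (chainMatroid_ground r q) ht).1 hsel
  refine ⟨ht1, Finset.mem_univ e, hlate, ?_⟩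
  intro j hj
  rw [sum_letterCount]
  refine le_trans (Set.ncard_le_ncard ?_ (Set.toFinite _))
    (ncard_le_of_notMem_closure he hcl ⟨j, hj⟩)
  rintro f ⟨hf, hfl, hlab⟩
  have hfe : t f < t e := by simpa using hf
  have hset : ((((Finset.univ.filter fun f => ¬ t e ≤ t f)).filter fun g => t g ≤ t f :
      Finset (Fin r × Fin q)) : Set (Fin r × Fin q)) = {g | t g ≤ t f} := by
    ext k
    simp only [Finset.coe_filter, Finset.mem_filter, Finset.mem_univ, true_and, not_le,
      Set.mem_ofPred_eq, and_iff_right_iff_imp]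
    exact fun hk => lt_of_le_of_lt hk hfe
  have hlab' : rowLabel r q succ (((Finset.univ.filter fun f => ¬ t e ≤ t f)).filter
      fun g => t g ≤ t f) f < j + 1 := by
    convert hlab
  unfold rowLabel at hlab'
  rw [hset] at hlab'
  split_ifs at hlab' with hopt
  · exact ⟨⟨hfl, hfe, hopt⟩, show f.1.val ≤ j by omega⟩
  · omega

lemma expectedMissing_row_le [DecidableEq (Fin r × Fin q)] (e : Fin r × Fin q) :
    expectedMissing r (fun f : Fin r × Fin q => f.1.val) (Finset.univ.erase e) 1 ≤
      r * (1 / 2 : ℝ) ^ (q - 1) := by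
  have h : ∀ j ∈ Finset.range r, (1 - 1 / (2 * 1) : ℝ) ^
      ((Finset.univ.erase e).filter fun f : Fin r × Fin q => f.1.val = j).card ≤
        (1 / 2 : ℝ) ^ (q - 1) := by
    intro j hj
    have hcard : (Finset.univ.filter fun f : Fin r × Fin q => f.1.val = j).card = q := by
      have : (Finset.univ.filter fun f : Fin r × Fin q => f.1.val = j) =
          {(⟨j, Finset.mem_range.1 hj⟩ : Fin r)} ×ˢ (Finset.univ : Finset (Fin q)) := by
        ext f
        simp only [Finset.mem_filter, Finset.mem_univ, true_and, Finset.mem_product,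
          Finset.mem_singleton, and_true, Fin.ext_iff]
      rw [this, Finset.card_product]
      simp
    have h2 : q - 1 ≤
        ((Finset.univ.erase e).filter fun f : Fin r × Fin q => f.1.val = j).card := by
      have h3 := Finset.pred_card_le_card_erase (a := e)
        (s := Finset.univ.filter fun f : Fin r × Fin q => f.1.val = j)
      rwa [hcard, ← Finset.filter_erase] at h3
    norm_num only
    exact pow_le_pow_of_le_one (by norm_num) (by norm_num) h2
  refine (Finset.sum_le_sum h).trans (le_of_eq ?_)
  simp

/-- The ratio of the algorithm on the nested laminar matroid is close to `1 - log 2`. -/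
lemma probCompetitiveRatio_chainMatroid_le (hr : 0 < r) (hq : 0 < q)
    (h : IsStrictTotalOrder (Fin r × Fin q) succ)
    (hrow : ∀ x y : Fin r × Fin q, x.1 < y.1 → succ x y) :
    probCompetitiveRatio (1 / 2) (chainMatroid r q) succ ≤ 1 - Real.log 2 +
      (Real.log 2 * Real.exp 1 / 2) ^ r / 2 + r * (1 / 2 : ℝ) ^ (q - 1) / 2 := by
  classical
  have hl1 : Real.log 2 < 1 := by linarith [Real.log_two_lt_d9]
  have hl0 : 0 ≤ Real.log 2 := Real.log_nonneg one_le_two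
  -- The best element of the first row is the one with small selection probability.
  obtain ⟨e, -, he0, hbest⟩ := exists_best h Finset.univ
    ⟨((⟨0, hr⟩, ⟨0, hq⟩) : Fin r × Fin q), Finset.mem_univ _, rfl⟩
  refine Real.sSup_le ?_ ?_
  · rintro α ⟨-, hα⟩
    refine (hα e (mem_opt_chainMatroid h hrow (Set.mem_univ e)
      fun x _ => hbest x (Finset.mem_univ x))).trans ((greedyImproving_le_outcomeProb he0).trans
      ((outcomeProb_le_one_sub_log_two r e (fun f : Fin r × Fin q => f.1.val) ?_).trans ?_))
    · intro S l hl hex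
      obtain ⟨b, hbS, hbl, hb⟩ := exists_best h S hex
      refine ⟨b, hbS, ?_⟩
      rw [rowLabel, if_pos (mem_opt_chainMatroid h hrow (Finset.mem_coe.2 hbS)
        fun x hx => hb x (Finset.mem_coe.1 hx)), hbl]
    · linarith [expectedMissing_row_le e]
  · have : 0 ≤ 1 - Real.log 2 := by linarith
    positivity

lemma exists_error_le {ε : ℝ} (hε : 0 < ε) : ∃ r q : ℕ, 0 < r ∧ 0 < q ∧
    (Real.log 2 * Real.exp 1 / 2) ^ r / 2 + r * (1 / 2 : ℝ) ^ (q - 1) / 2 ≤ ε := by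
  have hl0 : 0 ≤ Real.log 2 := Real.log_nonneg one_le_two
  have hb0 : 0 ≤ Real.log 2 * Real.exp 1 / 2 := by positivity
  -- The base is about 0.942. First `r` is chosen, then `q` large in terms of `r`.
  have hb1 : Real.log 2 * Real.exp 1 / 2 < 1 := by
    have h1 : Real.log 2 * Real.exp 1 ≤ 0.6931471808 * 2.7182818286 :=
      mul_le_mul Real.log_two_lt_d9.le Real.exp_one_lt_d9.le (Real.exp_pos _).le (by norm_num)
    norm_num at h1 ⊢
    linarith
  obtain ⟨r, hr⟩ := exists_pow_lt_of_lt_one hε hb1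
  obtain ⟨k, hk⟩ := exists_pow_lt_of_lt_one (div_pos hε (Nat.cast_add_one_pos (α := ℝ) r))
    (show (1 / 2 : ℝ) < 1 by norm_num)
  refine ⟨r + 1, k + 1, Nat.succ_pos _, Nat.succ_pos _, ?_⟩
  have h1 := pow_le_pow_of_le_one hb0 hb1.le (show r ≤ r + 1 by omega)
  rw [lt_div_iff₀ (Nat.cast_add_one_pos (α := ℝ) r)] at hk
  rw [Nat.add_sub_cancel]
  push_cast
  linarith

end Chain

end MatroidSecretary

open MatroidSecretary in
theorem theorem1 :
    (∀ (E : Type*) [Fintype E] (M : Matroid E), M.E = Set.univ → IsLaminar M →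
      ∀ succ : E → E → Prop, IsStrictTotalOrder E succ →
        IsProbCompetitive (1 / 2) M succ (1 - Real.log 2)) ∧
    (∀ ε : ℝ, 0 < ε →
      ∃ (r q : ℕ) (M : Matroid (Fin r × Fin q)),
        M.E = Set.univ ∧ IsLaminar M ∧ M.Loopless ∧
        (∀ I : Set (Fin r × Fin q),
          M.Indep I ↔ ∀ i : Fin r, (I ∩ {x | x.1 ≤ i}).encard ≤ (i.val + 1 : ℕ)) ∧
        ∀ succ : Fin r × Fin q → Fin r × Fin q → Prop,
          IsStrictTotalOrder (Fin r × Fin q) succ →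
          (∀ x y : Fin r × Fin q, x.1 < y.1 → succ x y) →
          probCompetitiveRatio (1 / 2) M succ ≤ 1 - Real.log 2 + ε) := by
  refine ⟨fun E _ M hE hM succ h => hM.isProbCompetitive hE h, fun ε hε => ?_⟩
  obtain ⟨r, q, hr, hq, hrq⟩ := exists_error_le hε
  refine ⟨r, q, chainMatroid r q, chainMatroid_ground r q, isLaminar_chainMatroid r q,
    loopless_chainMatroid r q, chainMatroid_indep_iff, fun succ h hrow => ?_⟩
  linarith [probCompetitiveRatio_chainMatroid_le hr hq h hrow]
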